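/- Let $d\in\mathbb N$, let $F$ be a locally compact Hausdorff space with a countable base, and let $E=[0,\infty)\times\mathbb R^d\times F$. Let $D_E$ be the space of right-continuous $E$-valued paths on $[0,\infty)$ with left limits, with coordinate process $X_t=(T_t,S_t,\eta_t)$, shifts $(\theta_t\omega)(s)=\omega(t+s)$, and the $\sigma$-algebra generated by the coordinates. Let $\mathbb F^0=(\mathcal F^0_t)$ be the raw filtration of $X$, let $\mathcal F_t=\bigcap_{s>t}\mathcal F^0_s$, $\mathbb F=(\mathcal F_t)$, and let $\mathcal T$ be the set of all bounded $\mathbb F$-stopping times. Let $(\mathbb P^x)_{x\in E}$ be probability measures on $D_E$, depending measurably on $x$, with the following properties. 1. (Strong Markov family) $\mathbb P^x[X_0=x]=1$ for all $x\in E$, and $\mathbb E^x[Z\circ\theta_\tau\mid\mathcal F_\tau]=\mathbb E^{X_\tau}[Z]$, $\mathbb P^x$-a.s., for all $x\in E$, $\tau\in\mathcal T$ and bounded measurable $Z:D_E\to\mathbb R$. 2. (Finite horizon) For every $x\in E$, $\mathbb P^x$-a.s., $T_t=T_0-t$ for all $t\le T_0$; and if $x\in\{0\}\times\mathbb R^d\times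 F$, then $\mathbb P^x$ is the Dirac mass at the constant path $x$. 3. (NFLVR) For every $x\in E$ the set $\mathcal M^x$ of all probability measures $\mathbb Q\sim\mathbb P^x$ on $D_E$ under which $S$ is an $\mathbb F^0$-local martingale is nonempty. 4. (Uniform local boundedness from below) With $\tau_n=\inf\{t\ge0:|S_t|\ge n\}$, for each $n\in\mathbb N$ there is a constant $a_n\in\mathbb R$ such that $\mathbb P^x[S^{\tau_n}_t\ge a_n\text{ coordinatewise for all }t\ge0]=1$ for every $x=(T,s,\eta)\in E$ with $|s|<n$. Then for every $x\in E$, $\mathbb Q\in\mathcal M^x$ and $\tau\in\mathcal T$, a regular conditional distribution $q_y=\mathbb Q[\theta_\tau\in\cdot\mid X_\tau=y]$ of $\theta_\tau$ given $X_\tau$ exists, and every version of it satisfies $$q_y\in\mathcal M^y\quad\text{for }\mathbb Q\circ X_\tau^{-1}\text{-almost every }y\in E.$$ -/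

import Mathlib

open MeasureTheory ProbabilityTheory Filter Topology
open scoped NNReal ENNReal

noncomputable section

namespace CanonicalPath

/-- A path on `[0,∞)` is RCLL if it is right-continuous and has left limits (in `E`). -/
def IsRCLL {E : Type*} [TopologicalSpace E] (w : ℝ≥0 → E) : Prop :=
  (∀ t, ContinuousWithinAt w (Set.Ici t) t) ∧ ∀ t, ∃ l, Tendsto w (𝓝[<] t) (𝓝 l)

/-- The space `D_E` of all `E`-valued RCLL paths on `[0,∞)`. -/
def PathSpace (E : Type*) [TopologicalSpace E] : Type _ := {w : ℝ≥0 → E // IsRCLL w}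

section General

variable {E : Type*} [TopologicalSpace E]

/-- The coordinate process `X_t(ω) = ω(t)`. -/
def coord (t : ℝ≥0) (ω : PathSpace E) : E := ω.1 t

/-- The `σ`-algebra on `D_E` generated by the coordinate maps (for Polish `E` it is the Borel
`σ`-algebra of the Skorokhod topology). -/
instance [MeasurableSpace E] : MeasurableSpace (PathSpace E) :=
  ⨆ t : ℝ≥0, MeasurableSpace.comap (coord t) inferInstance

theorem measurable_coord [MeasurableSpace E] (t : ℝ≥0) :
    Measurable (coord t : PathSpace E → E) :=
  Measurable.of_comap_le (le_iSup (fun t : ℝ≥0 =>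
    MeasurableSpace.comap (coord t : PathSpace E → E) inferInstance) t)

theorem isRCLL_shift {w : ℝ≥0 → E} (hw : IsRCLL w) (t : ℝ≥0) :
    IsRCLL fun s => w (t + s) := by
  refine ⟨fun s => ?_, fun s => ?_⟩
  · refine (hw.1 (t + s)).comp (by fun_prop) ?_
    intro u hu
    exact add_le_add_right (Set.mem_Ici.1 hu) t
  · obtain ⟨l, hl⟩ := hw.2 (t + s)
    refine ⟨l, hl.comp ?_⟩
    refine tendsto_nhdsWithin_iff.2 ⟨?_, ?_⟩
    · exact tendsto_nhdsWithin_of_tendsto_nhds (Continuous.tendsto (by fun_prop) s)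
    · filter_upwards [self_mem_nhdsWithin] with u hu
      exact add_lt_add_right (Set.mem_Iio.1 hu) t

/-- The shift operator `θ_t`, with `X_s (θ_t ω) = X_{t+s} ω`. -/
def shift (t : ℝ≥0) (ω : PathSpace E) : PathSpace E := ⟨fun s => ω.1 (t + s), isRCLL_shift ω.2 t⟩

/-- The path with constant value `x`. -/
def constPath (x : E) : PathSpace E :=
  ⟨fun _ => x, fun _ => continuousWithinAt_const, fun _ => ⟨x, tendsto_const_nhds⟩⟩

/-- `X_τ` for a finite random time `τ`. -/
def coordAt (τ : PathSpace E → ℝ≥0) (ω : PathSpace E) : E := coord (τ ω) ω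

/-- `θ_τ` for a finite random time `τ`. -/
def shiftAt (τ : PathSpace E → ℝ≥0) (ω : PathSpace E) : PathSpace E := shift (τ ω) ω

variable [MeasurableSpace E]

/-- `X_τ` is measurable for every measurable `τ`, so that its law is a genuine push-forward. -/
theorem measurable_coordAt [TopologicalSpace.PseudoMetrizableSpace E] [BorelSpace E]
    {τ : PathSpace E → ℝ≥0} (hτ : Measurable τ) : Measurable (coordAt τ) := by
  have hlim : ∀ x : ℝ≥0, Tendsto (fun n : ℕ => ((⌊x * (n + 1)⌋₊ : ℝ≥0) + 1) / (n + 1)) atTop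
      (𝓝[≥] x) := by
    intro x
    have hpos : ∀ n : ℕ, (0 : ℝ≥0) < n + 1 := fun n => by positivity
    have hge : ∀ n : ℕ, x ≤ ((⌊x * (n + 1)⌋₊ : ℝ≥0) + 1) / (n + 1) := fun n => by
      rw [le_div_iff₀ (hpos n)]
      exact (Nat.lt_floor_add_one _).le
    refine tendsto_nhdsWithin_iff.2 ⟨?_, Eventually.of_forall hge⟩
    have hup : ∀ n : ℕ, ((⌊x * (n + 1)⌋₊ : ℝ≥0) + 1) / (n + 1) ≤ x + 1 / (n + 1) := fun n => by
      rw [add_div]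
      gcongr
      rw [div_le_iff₀ (hpos n)]
      exact Nat.floor_le (by positivity)
    have h0 : Tendsto (fun n : ℕ => x + 1 / ((n : ℝ≥0) + 1)) atTop (𝓝 (x + 0)) :=
      tendsto_const_nhds.add (tendsto_one_div_add_atTop_nhds_zero_nat (𝕜 := ℝ≥0))
    rw [add_zero] at h0
    exact tendsto_of_tendsto_of_tendsto_of_le_of_le tendsto_const_nhds h0 hge hup
  refine measurable_of_tendsto_metrizable
    (f := fun (n : ℕ) ω => coord (((⌊τ ω * (n + 1)⌋₊ : ℝ≥0) + 1) / (n + 1)) ω) (fun n => ?_) ?_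
  · have h1 : Measurable fun p : ℕ × PathSpace E =>
        coord (((p.1 : ℝ≥0) + 1) / (n + 1)) p.2 :=
      measurable_from_prod_countable_right fun k => by
        exact measurable_coord (((k : ℝ≥0) + 1) / (n + 1))
    exact h1.comp ((Nat.measurable_floor.comp (hτ.mul_const _)).prodMk measurable_id)
  · refine tendsto_pi_nhds.2 fun ω => ?_
    exact ((ω.2.1 (τ ω)).tendsto).comp (hlim (τ ω))

/-- `θ_τ` is measurable for every measurable `τ`. -/
theorem measurable_shiftAt [TopologicalSpace.PseudoMetrizableSpace E] [BorelSpace E]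
    {τ : PathSpace E → ℝ≥0} (hτ : Measurable τ) : Measurable (shiftAt τ) := by
  refine Measurable.of_le_map (iSup_le fun s => ?_)
  rw [MeasurableSpace.comap_le_iff_le_map, MeasurableSpace.map_comp]
  exact Measurable.le_map (measurable_coordAt (τ := fun ω => τ ω + s) (hτ.add_const s))

/-- `κ` is a regular conditional distribution of `θ_τ` given `X_τ` under `μ`: the joint law of
`(X_τ, θ_τ)` disintegrates as `(law of X_τ)(dy) κ_y(dω')`. -/
def IsRegularCondDistrib (μ : Measure (PathSpace E)) (τ : PathSpace E → ℝ≥0)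
    (κ : Kernel E (PathSpace E)) : Prop :=
  IsMarkovKernel κ ∧
    μ.map (fun ω => (coordAt τ ω, shiftAt τ ω)) = (μ.map (coordAt τ)) ⊗ₘ κ

/-- The condition `μ[θ_τ ∈ · | X_τ = y] ∈ 𝓡^y` for `μ ∘ X_τ⁻¹`-almost all `y`, for every `x`, every
`μ ∈ 𝓡^x` and every `τ ∈ 𝒯`: a regular conditional distribution exists, and each version of it
takes its values in the family, up to a null set. -/
def ConditionalLawsBelong (𝓡 : E → Set (Measure (PathSpace E)))
    (𝒯 : Set (PathSpace E → ℝ≥0)) : Prop :=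
  ∀ x, ∀ μ ∈ 𝓡 x, ∀ τ ∈ 𝒯,
    (∃ κ : Kernel E (PathSpace E), IsRegularCondDistrib μ τ κ) ∧
    ∀ κ : Kernel E (PathSpace E), IsRegularCondDistrib μ τ κ →
      ∀ᵐ y ∂(μ.map (coordAt τ)), κ y ∈ 𝓡 y

/-- The raw filtration `ℱ⁰` generated by the coordinate process. -/
def rawFiltration (E : Type*) [TopologicalSpace E] [MeasurableSpace E] :
    Filtration ℝ≥0 (inferInstance : MeasurableSpace (PathSpace E)) where
  seq t := ⨆ s ≤ t, MeasurableSpace.comap (coord s) inferInstance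
  mono' _ _ h := biSup_mono fun _ hs => hs.trans h
  le' _ := iSup₂_le fun s _ => (measurable_coord s).comap_le

/-- The right-continuous hull `ℱ_t = ⋂_{s > t} ℱ⁰_s` of the raw filtration. -/
def rightFiltration (E : Type*) [TopologicalSpace E] [MeasurableSpace E] :
    Filtration ℝ≥0 (inferInstance : MeasurableSpace (PathSpace E)) where
  seq t := ⨅ s > t, rawFiltration E s
  mono' _ _ h := biInf_mono fun _ hs => lt_of_le_of_lt h hs
  le' t := (iInf₂_le (t + 1) (lt_add_of_pos_right t one_pos)).trans ((rawFiltration E).le _)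

/-- The bounded stopping times of the right-continuous filtration. -/
def boundedStoppingTimes (E : Type*) [TopologicalSpace E] [MeasurableSpace E] :
    Set (PathSpace E → ℝ≥0) :=
  {τ | IsStoppingTime (rightFiltration E) (fun ω => (τ ω : WithTop ℝ≥0)) ∧ ∃ N, ∀ ω, τ ω ≤ N}

/-- `(ℙ^x)` is a canonical strong Markov family: `x ↦ ℙ^x` is measurable (it is a kernel), `ℙ^x` is
a probability with `ℙ^x[X_0 = x] = 1`, and `𝔼^x[Z ∘ θ_τ | ℱ_τ] = 𝔼^{X_τ}[Z]`, `ℙ^x`-a.s., for all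
bounded stopping times `τ` and all bounded measurable `Z`. -/
structure IsCanonicalStrongMarkov (P : Kernel E (PathSpace E)) : Prop where
  isMarkovKernel : IsMarkovKernel P
  start : ∀ x, ∀ᵐ ω ∂(P x), coord 0 ω = x
  strongMarkov : ∀ (τ : PathSpace E → ℝ≥0)
    (hτ : IsStoppingTime (rightFiltration E) (fun ω => (τ ω : WithTop ℝ≥0))),
    (∃ N, ∀ ω, τ ω ≤ N) → ∀ (x : E) (Z : PathSpace E → ℝ), Measurable Z → (∃ C, ∀ ω, |Z ω| ≤ C) →
      (P x)[fun ω => Z (shiftAt τ ω) | hτ.measurableSpace]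
        =ᵐ[P x] fun ω => ∫ ω', Z ω' ∂(P (coordAt τ ω))

end General

section Market

/-- The state space `[0,∞) × ℝ^d × F`. -/
abbrev State (d : ℕ) (F : Type*) : Type _ := ℝ≥0 × EuclideanSpace ℝ (Fin d) × F

variable {d : ℕ} {F : Type*} [TopologicalSpace F]

/-- The time-to-go component `T` of the coordinate process. -/
def timeToGo (t : ℝ≥0) (ω : PathSpace (State d F)) : ℝ≥0 := (coord t ω).1

/-- The asset-price component `S` of the coordinate process. -/
def price (t : ℝ≥0) (ω : PathSpace (State d F)) : EuclideanSpace ℝ (Fin d) := (coord t ω).2.1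

/-- `τ_n = inf {t ≥ 0 | |S_t| ≥ n}` (with `inf ∅ = ∞`). -/
def priceExit (n : ℕ) : PathSpace (State d F) → WithTop ℝ≥0 :=
  hittingAfter price {s | (n : ℝ) ≤ ‖s‖} 0

variable [MeasurableSpace F]

/-- `S` is a local martingale under `Q` in the raw filtration. -/
def IsLocalMartingalePrice (Q : Measure (PathSpace (State d F))) : Prop :=
  Locally (fun Y => Martingale Y (rawFiltration (State d F)) Q) (rawFiltration (State d F))
    (price (d := d) (F := F)) Q

/-- The set `ℳ^x` of probability measures equivalent to `ℙ^x` under which `S` is a local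
martingale. -/
def equivLocalMartingaleMeasures (P : Kernel (State d F) (PathSpace (State d F)))
    (x : State d F) : Set (Measure (PathSpace (State d F))) :=
  {Q | IsProbabilityMeasure Q ∧ Q ≪ P x ∧ P x ≪ Q ∧ IsLocalMartingalePrice Q}

/-- Finite horizon: `T` runs down at unit speed to zero, and the states with no time to go are
absorbing. -/
structure FiniteHorizon (P : Kernel (State d F) (PathSpace (State d F))) : Prop where
  countdown : ∀ x, ∀ᵐ ω ∂(P x), ∀ t, t ≤ timeToGo 0 ω →
    (timeToGo t ω : ℝ) = (timeToGo 0 ω : ℝ) - t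
  absorbing : ∀ x : State d F, x.1 = 0 → P x = Measure.dirac (constPath x)

/-- Uniform local boundedness from below: for each `n` there is a constant `a` with
`ℙ^x[S^{τ_n} ≥ a] = 1` (coordinatewise) for all starting points `x` whose price component has norm
less than `n`. -/
def UniformlyLocallyBoundedBelow (P : Kernel (State d F) (PathSpace (State d F))) : Prop :=
  ∀ n : ℕ, ∃ a : ℝ, ∀ x : State d F, ‖x.2.1‖ < n →
    ∀ᵐ ω ∂(P x), ∀ (t : ℝ≥0) (i : Fin d), a ≤ stoppedProcess price (priceExit n) t ω i

end Market

end CanonicalPath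

end

/-! The strong Markov property says that under `P x` the pair `(X_τ, θ_τ)` has law `(law of X_τ) ⊗ₘ
P`. If `Q ~ P x`, its joint law is therefore equivalent to `(Q.map X_τ) ⊗ₘ P`. A density then gives
a disintegration, and every version `κ` has `κ y ~ P y` for almost every `y`. It remains to show
that the price is a local martingale under `κ y` (`exists_isMarkovKernel_compProd_eq`,
`ae_martingale_of_map_eq_compProd`, `martingale_stoppedPrice_map_shiftAt` carry the proof).

The localizing sequence must not depend on `y`. Take `σ_n`, the time at which the running supremum
of `|S|` reaches `n`; it is a stopping time of the raw filtration and precedes `τ_n`. The uniform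
lower bound on `S^{τ_n}` thus gives one for `S^{σ_n}` that is the same for all starting points, so
by the Markov property it holds for the path after `τ`, under `P x` and hence under `Q`.

Let `ρ_k` localize `S` under `Q`. Sampling `S^{ρ_k}` at `τ + t ∧ σ_n ∘ θ_τ` and letting `k → ∞`,
Fatou's lemma with the lower bound gives integrability of the shifted stopped price. Before `σ_n`
the price has norm below `n`, so all localized values are dominated by `n` plus the norm of the
terminal value, and the martingale identity passes to the limit. Finally, conditioning on the
initial state keeps the martingale property almost surely, since right-continuity and countable
generation reduce it to countably many integral identities. -/

namespace CanonicalPath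

/-! ### Right-continuous functions, dense times and grid approximation -/

section RightContinuous

variable {X : Type*} [TopologicalSpace X]

/-- A right-continuous function maps `u` into a closed set if it does so for all points of a dense
set slightly to the right of `u`. -/
theorem mem_of_isClosed_of_forall_dense {w : ℝ≥0 → X}
    (hw : ∀ t, ContinuousWithinAt w (Set.Ici t) t) {C : Set X} (hC : IsClosed C) {D : Set ℝ≥0}
    (hD : Dense D) {u t : ℝ≥0} (hut : u < t) (h : ∀ q ∈ D, u < q → q < t → w q ∈ C) : w u ∈ C := by
  have hcl : u ∈ closure (Set.Ioo u t ∩ D) := by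
    have h1 : u ∈ closure (Set.Ioo u t) := by
      rw [closure_Ioo hut.ne]; exact Set.left_mem_Icc.2 hut.le
    exact closure_minimal (hD.open_subset_closure_inter isOpen_Ioo) isClosed_closure h1
  have hcont : ContinuousWithinAt w (Set.Ioo u t ∩ D) u :=
    (hw u).mono fun q hq => hq.1.1.le
  have := hcont.mem_closure hcl (t := C) fun q hq => h q hq.2 hq.1.1 hq.1.2
  rwa [hC.closure_eq] at this

theorem exists_seq_dense_tendsto_right {D : Set ℝ≥0} (hD : Dense D) {u t : ℝ≥0} (hut : u < t) :
    ∃ q : ℕ → ℝ≥0, (∀ k, q k ∈ D ∧ u < q k ∧ q k < t) ∧ Tendsto q atTop (𝓝[≥] u) := by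
  have hcl : u ∈ closure (Set.Ioo u t ∩ D) := by
    have h1 : u ∈ closure (Set.Ioo u t) := by
      rw [closure_Ioo hut.ne]; exact Set.left_mem_Icc.2 hut.le
    exact closure_minimal (hD.open_subset_closure_inter isOpen_Ioo) isClosed_closure h1
  obtain ⟨q, hq, hlim⟩ := mem_closure_iff_seq_limit.1 hcl
  refine ⟨q, fun k => ⟨(hq k).2, (hq k).1.1, (hq k).1.2⟩, ?_⟩
  exact tendsto_nhdsWithin_iff.2 ⟨hlim, Eventually.of_forall fun k => (hq k).1.1.le⟩

/-- Approximation of `x` from the right by multiples of `1 / (n + 1)`. -/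
noncomputable def gridAbove (n : ℕ) (x : ℝ≥0) : ℝ≥0 := ((⌊x * (n + 1)⌋₊ : ℝ≥0) + 1) / (n + 1)

theorem lt_gridAbove (n : ℕ) (x : ℝ≥0) : x < gridAbove n x := by
  rw [gridAbove, lt_div_iff₀ (by positivity)]
  exact Nat.lt_floor_add_one _

theorem gridAbove_le (n : ℕ) (x : ℝ≥0) : gridAbove n x ≤ x + 1 / (n + 1) := by
  rw [gridAbove, add_div]
  gcongr
  rw [div_le_iff₀ (by positivity)]
  exact Nat.floor_le (by positivity)

theorem gridAbove_le_add_one (n : ℕ) (x : ℝ≥0) : gridAbove n x ≤ x + 1 := by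
  refine (gridAbove_le n x).trans (by gcongr; exact div_le_one_of_le₀ (by simp) (by positivity))

theorem tendsto_gridAbove (x : ℝ≥0) : Tendsto (fun n => gridAbove n x) atTop (𝓝[≥] x) := by
  refine tendsto_nhdsWithin_iff.2 ⟨?_, Eventually.of_forall fun n => (lt_gridAbove n x).le⟩
  have h0 : Tendsto (fun n : ℕ => x + 1 / ((n : ℝ≥0) + 1)) atTop (𝓝 (x + 0)) :=
    tendsto_const_nhds.add (tendsto_one_div_add_atTop_nhds_zero_nat (𝕜 := ℝ≥0))
  rw [add_zero] at h0
  exact tendsto_of_tendsto_of_tendsto_of_le_of_le tendsto_const_nhds h0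
    (fun n => (lt_gridAbove n x).le) (fun n => gridAbove_le n x)

/-- The strict inequality on the right is the point: only the events `{V < q}` with `q ≤ r` enter,
so the grid time is a stopping time even when `V` is merely optional. -/
theorem gridAbove_le_iff (n : ℕ) (x r : ℝ≥0) :
    gridAbove n x ≤ r ↔ x < (⌊r * (n + 1)⌋₊ : ℝ≥0) / (n + 1) := by
  rw [gridAbove, div_le_iff₀ (by positivity), lt_div_iff₀ (by positivity),
    ← Nat.floor_lt (by positivity), ← Nat.succ_le_iff, Nat.le_floor_iff (by positivity)]
  simp

/-- Right-continuous processes that are measurable up to time `r` are measurable at measurable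
random times bounded by `r`. -/
theorem measurable_apply_of_rightContinuous [TopologicalSpace.PseudoMetrizableSpace X]
    [MeasurableSpace X] [BorelSpace X] {Ω : Type*} [MeasurableSpace Ω] {w : ℝ≥0 → Ω → X} {r : ℝ≥0}
    (hw : ∀ ω t, ContinuousWithinAt (fun u => w u ω) (Set.Ici t) t)
    (hm : ∀ u ≤ r, Measurable (w u)) {ζ : Ω → ℝ≥0} (hζ : Measurable ζ) (hle : ∀ ω, ζ ω ≤ r) :
    Measurable fun ω => w (ζ ω) ω := by
  refine measurable_of_tendsto_metrizable
    (f := fun (n : ℕ) ω => w (min (gridAbove n (ζ ω)) r) ω) (fun n => ?_) ?_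
  · have h1 : Measurable fun p : ℕ × Ω => w (min (((p.1 : ℝ≥0) + 1) / (n + 1)) r) p.2 :=
      measurable_from_prod_countable_right fun k =>
        hm (min (((k : ℝ≥0) + 1) / (n + 1)) r) (min_le_right _ _)
    have h2 : Measurable fun ω => (⌊ζ ω * (n + 1)⌋₊, ω) :=
      (Nat.measurable_floor.comp (hζ.mul_const _)).prodMk measurable_id
    have h3 := h1.comp h2
    simp only [Function.comp_def] at h3
    simpa only [gridAbove] using h3
  · refine tendsto_pi_nhds.2 fun ω => (hw ω (ζ ω)).tendsto.comp ?_
    have h := tendsto_nhdsWithin_iff.1 (tendsto_gridAbove (ζ ω))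
    refine tendsto_nhdsWithin_iff.2 ⟨?_, ?_⟩
    · simpa [min_eq_left (hle ω)] using h.1.min (tendsto_const_nhds (x := r))
    · exact h.2.mono fun n hn => le_min hn (hle ω)

end RightContinuous

/-! ### Coordinate σ-algebras and shifts on path space -/

theorem countablyGenerated_iSup {α ι : Type*} [Countable ι] {m : ι → MeasurableSpace α}
    (h : ∀ i, @MeasurableSpace.CountablyGenerated α (m i)) :
    @MeasurableSpace.CountablyGenerated α (⨆ i, m i) := by
  choose b hb hm using fun i => (h i).1
  refine @MeasurableSpace.CountablyGenerated.mk α (⨆ i, m i)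
    ⟨⋃ i, b i, Set.countable_iUnion hb, ?_⟩
  rw [← MeasurableSpace.iSup_generateFrom]
  exact iSup_congr hm

section Paths

variable {E : Type*} [TopologicalSpace E]

theorem coord_shiftAt (τ : PathSpace E → ℝ≥0) (s : ℝ≥0) (ω : PathSpace E) :
    coord s (shiftAt τ ω) = coord (τ ω + s) ω := rfl

theorem coord_zero_shiftAt (τ : PathSpace E → ℝ≥0) (ω : PathSpace E) :
    coord 0 (shiftAt τ ω) = coordAt τ ω := by
  simp [coord_shiftAt, coordAt]

variable [MeasurableSpace E]

theorem measurable_coord_rawFiltration {u s : ℝ≥0} (h : u ≤ s) :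
    Measurable[rawFiltration E s] (coord u : PathSpace E → E) :=
  Measurable.of_comap_le (le_iSup₂_of_le (f := fun u (_ : u ≤ s) =>
    MeasurableSpace.comap (coord u : PathSpace E → E) inferInstance) u h le_rfl)

theorem measurableSet_lt_of_isStoppingTime_rightFiltration {τ : PathSpace E → ℝ≥0}
    (hτ : IsStoppingTime (rightFiltration E) (fun ω => (τ ω : WithTop ℝ≥0))) (r : ℝ≥0) :
    MeasurableSet[rawFiltration E r] {ω | τ ω < r} := by
  obtain ⟨D, hDc, hD⟩ := TopologicalSpace.exists_countable_dense ℝ≥0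
  have : {ω | τ ω < r} = ⋃ q ∈ D ∩ Set.Iio r, {ω | τ ω ≤ q} := by
    ext ω
    simp only [Set.mem_ofPred_eq, Set.mem_iUnion, Set.mem_inter_iff, Set.mem_Iio, exists_prop]
    constructor
    · intro h
      obtain ⟨q, hq, h1, h2⟩ := hD.exists_between h
      exact ⟨q, ⟨hq, h2⟩, h1.le⟩
    · rintro ⟨q, ⟨_, h2⟩, h1⟩
      exact h1.trans_lt h2
  rw [this]
  refine MeasurableSet.biUnion (hDc.mono Set.inter_subset_left) fun q hq => ?_
  have h1 : MeasurableSet[rightFiltration E q] {ω | (τ ω : WithTop ℝ≥0) ≤ q} := hτ q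
  simp only [WithTop.coe_le_coe] at h1
  exact (iInf₂_le (f := fun s (_ : s > q) => rawFiltration E s) r hq.2) _ h1

theorem iSup_rawFiltration :
    ⨆ n : ℕ, rawFiltration E (n : ℝ≥0) = (inferInstance : MeasurableSpace (PathSpace E)) := by
  refine le_antisymm (iSup_le fun n => (rawFiltration E).le _) (iSup_le fun t => ?_)
  obtain ⟨n, hn⟩ := exists_nat_ge t
  exact le_iSup_of_le n (measurable_coord_rawFiltration hn).comap_le

variable [TopologicalSpace.PseudoMetrizableSpace E] [BorelSpace E]

/-- For `u < s` the coordinate at `u` is a limit of coordinates at dense times in `(u, s)`. The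
endpoint `s` must be added by hand, as approximating it from the right would look into the future.
-/
theorem rawFiltration_eq_iSup_dense {D : Set ℝ≥0} (hD : Dense D) (s : ℝ≥0) :
    (rawFiltration E s : MeasurableSpace (PathSpace E)) =
      ⨆ q ∈ insert s (D ∩ Set.Iio s), MeasurableSpace.comap (coord q) inferInstance := by
  apply le_antisymm
  · refine iSup₂_le fun u hu => ?_
    rcases hu.eq_or_lt with rfl | hu
    · exact le_iSup₂_of_le u (Set.mem_insert _ _) le_rfl
    · obtain ⟨q, hq, hlim⟩ := exists_seq_dense_tendsto_right hD hu
      rw [← measurable_iff_comap_le]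
      refine @measurable_of_tendsto_metrizable _ _ (_) _ _ _ _ (fun k => coord (q k)) _ (fun k => ?_)
        (tendsto_pi_nhds.2 fun ω => (ω.2.1 u).tendsto.comp hlim)
      exact Measurable.of_comap_le (le_iSup₂_of_le (q k)
        (Set.mem_insert_of_mem _ ⟨(hq k).1, (hq k).2.2⟩) le_rfl)
  · refine iSup₂_le fun q hq => (measurable_coord_rawFiltration ?_).comap_le
    rcases hq with rfl | hq
    · rfl
    · exact hq.2.le

theorem countablyGenerated_rawFiltration [SecondCountableTopology E] (s : ℝ≥0) :
    @MeasurableSpace.CountablyGenerated (PathSpace E) (rawFiltration E s) := by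
  obtain ⟨D, hDc, hD⟩ := TopologicalSpace.exists_countable_dense ℝ≥0
  rw [rawFiltration_eq_iSup_dense hD s, iSup_subtype']
  have : Countable ↥(insert s (D ∩ Set.Iio s)) :=
    ((hDc.mono Set.inter_subset_left).insert s).to_subtype
  exact countablyGenerated_iSup fun q => MeasurableSpace.CountablyGenerated.comap _

theorem countablyGenerated_pathSpace [SecondCountableTopology E] :
    MeasurableSpace.CountablyGenerated (PathSpace E) := by
  have := countablyGenerated_iSup (m := fun n : ℕ => rawFiltration E (n : ℝ≥0))
    fun n => countablyGenerated_rawFiltration (E := E) (n : ℝ≥0)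
  rwa [iSup_rawFiltration] at this

theorem measurable_shiftAt_rawFiltration {r s : ℝ≥0} {τ : PathSpace E → ℝ≥0}
    (hτ : Measurable[rawFiltration E r] τ) (hle : ∀ ω, τ ω + s ≤ r) :
    Measurable[rawFiltration E r, rawFiltration E s] (shiftAt τ) := by
  refine @Measurable.of_le_map _ _ (rawFiltration E r) (rawFiltration E s) _
    (iSup₂_le fun u hu => ?_)
  rw [MeasurableSpace.comap_le_iff_le_map, MeasurableSpace.map_comp]
  refine @Measurable.le_map _ _ (rawFiltration E r) _ _ ?_
  refine @measurable_apply_of_rightContinuous E _ _ _ _ _ (rawFiltration E r)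
    (fun u ω => coord u ω) r (fun ω => ω.2.1) (fun u hu => measurable_coord_rawFiltration hu)
    (fun ω => τ ω + u) ?_ (fun ω => le_trans (by gcongr) (hle ω))
  exact @Measurable.add_const _ _ _ _ (rawFiltration E r) τ _ hτ u

/-- Events of the shifted path up to time `s` are known at every time after `τ + s`. -/
theorem measurableSet_shiftAt_inter_lt {τ : PathSpace E → ℝ≥0}
    (hτ : ∀ r, MeasurableSet[rawFiltration E r] {ω | τ ω < r}) {s : ℝ≥0} {A : Set (PathSpace E)}
    (hA : MeasurableSet[rawFiltration E s] A) (r : ℝ≥0) :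
    MeasurableSet[rawFiltration E r] ({ω | shiftAt τ ω ∈ A} ∩ {ω | τ ω + s < r}) := by
  classical
  have hlt : ∀ q ≤ r, MeasurableSet[rawFiltration E r] {ω | τ ω < q} := fun q hq =>
    (rawFiltration E).mono hq _ (hτ q)
  rcases le_or_gt r s with hrs | hrs
  · have : {ω | τ ω + s < r} = ∅ := Set.eq_empty_of_forall_notMem fun ω hω =>
      (hrs.trans le_add_self).not_gt hω
    rw [this, Set.inter_empty]
    exact @MeasurableSet.empty _ (rawFiltration E r)
  -- Truncation makes the random time measurable at time `r` with `τ' + s ≤ r` everywhere, and it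
  -- agrees with `τ` on the event of interest.
  set τ' : PathSpace E → ℝ≥0 := fun ω => if τ ω < r - s then τ ω else 0 with hτ'
  have hiff : ∀ ω, τ ω + s < r ↔ τ ω < r - s := fun ω => lt_tsub_iff_right.symm
  have hset : {ω | τ ω + s < r} = {ω | τ ω < r - s} := Set.ext hiff
  have hmeas : Measurable[rawFiltration E r] τ' := by
    refine @measurable_of_Iio _ _ _ _ _ (rawFiltration E r) _ _ _ _ fun q => ?_
    have : τ' ⁻¹' Set.Iio q =
        {ω | τ ω < min q (r - s)} ∪ ({ω | τ ω < r - s}ᶜ ∩ {_ω | 0 < q}) := by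
      ext ω
      simp only [hτ', Set.mem_preimage, Set.mem_Iio, Set.mem_union, Set.mem_ofPred_eq, lt_min_iff,
        Set.mem_inter_iff, Set.mem_compl_iff]
      split_ifs with h <;> simp [h]
    rw [this]
    refine @MeasurableSet.union _ (rawFiltration E r) _ _
      (hlt _ ((min_le_right _ _).trans tsub_le_self)) ?_
    exact @MeasurableSet.inter _ (rawFiltration E r) _ _
      (@MeasurableSet.compl _ _ (rawFiltration E r) (hlt _ tsub_le_self))
      (@MeasurableSet.const _ (rawFiltration E r) _)
  have hle : ∀ ω, τ' ω + s ≤ r := fun ω => by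
    simp only [hτ']
    split_ifs with h
    · exact ((hiff ω).2 h).le
    · simpa using hrs.le
  have heq : {ω | shiftAt τ ω ∈ A} ∩ {ω | τ ω + s < r} =
      shiftAt τ' ⁻¹' A ∩ {ω | τ ω < r - s} := by
    rw [hset]
    ext ω
    simp only [Set.mem_inter_iff, Set.mem_ofPred_eq, Set.mem_preimage, and_congr_left_iff]
    intro h
    simp only [shiftAt, hτ', if_pos h]
  rw [heq]
  exact @MeasurableSet.inter _ (rawFiltration E r) _ _
    (measurable_shiftAt_rawFiltration hmeas hle hA) (hlt _ tsub_le_self)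

end Paths

/-! ### Optional sampling at optional times -/

section Martingales

variable {Ω : Type*} {m : MeasurableSpace Ω} {μ : Measure Ω} [IsFiniteMeasure μ]
  {ℱ : Filtration ℝ≥0 m}

theorem martingale_of_forall_setIntegral_eq {X : Type*} [NormedAddCommGroup X] [NormedSpace ℝ X]
    [CompleteSpace X] {M : ℝ≥0 → Ω → X} (hadapt : StronglyAdapted ℱ M)
    (hint : ∀ t, Integrable (M t) μ)
    (heq : ∀ s t, s ≤ t → ∀ A, MeasurableSet[ℱ s] A → ∫ ω in A, M s ω ∂μ = ∫ ω in A, M t ω ∂μ) :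
    Martingale M ℱ μ :=
  ⟨hadapt, fun s t hst => (ae_eq_condExp_of_forall_setIntegral_eq (ℱ.le s) (hint t)
    (fun _ _ _ => (hint s).integrableOn) (fun A hA _ => heq s t hst A hA)
    (hadapt s).aestronglyMeasurable).symm⟩

/-- Optional sampling at a bounded random time `V` with `{V < r} ∈ ℱ_r` for a right-continuous
martingale. -/
theorem integral_apply_eq_of_martingale {M : ℝ≥0 → Ω → ℝ} (hM : Martingale M ℱ μ)
    (hcont : ∀ ω t, ContinuousWithinAt (fun u => M u ω) (Set.Ici t) t) {V : Ω → ℝ≥0}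
    (hV : ∀ r, MeasurableSet[ℱ r] {ω | V ω < r}) {N : ℝ≥0} (hN : ∀ ω, V ω ≤ N) :
    Integrable (fun ω => M (V ω) ω) μ ∧ ∫ ω, M (V ω) ω ∂μ = ∫ ω, M (N + 1) ω ∂μ := by
  have hgrid : ∀ n : ℕ, IsStoppingTime ℱ fun ω => (gridAbove n (V ω) : WithTop ℝ≥0) := by
    intro n r
    simp only [WithTop.coe_le_coe, gridAbove_le_iff]
    refine ℱ.mono ?_ _ (hV _)
    rw [div_le_iff₀ (by positivity)]
    exact Nat.floor_le (by positivity)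
  have hle : ∀ n : ℕ, ∀ ω, (gridAbove n (V ω) : WithTop ℝ≥0) ≤ (N + 1 : ℝ≥0) := fun n ω =>
    WithTop.coe_le_coe.2 ((gridAbove_le_add_one n _).trans (by gcongr; exact hN ω))
  have hcount : ∀ n : ℕ, (Set.range fun ω => (gridAbove n (V ω) : WithTop ℝ≥0)).Countable := by
    intro n
    refine (Set.countable_range fun k : ℕ =>
      ((((k : ℝ≥0) + 1) / (n + 1) : ℝ≥0) : WithTop ℝ≥0)).mono ?_
    rintro _ ⟨ω, rfl⟩
    exact ⟨⌊V ω * (n + 1)⌋₊, rfl⟩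
  have hm : ∀ n, (hgrid n).measurableSpace ≤ m := fun n =>
    (hgrid n).measurableSpace_le_of_le (hle n)
  have hae : ∀ n : ℕ, μ[M (N + 1) | (hgrid n).measurableSpace]
      =ᵐ[μ] fun ω => M (gridAbove n (V ω)) ω := fun n =>
    (hM.stoppedValue_ae_eq_condExp_of_le_const_of_countable_range (hgrid n) (hle n)
      (hcount n)).symm
  -- All grid values are conditional expectations of the single variable `M (N + 1)`, hence
  -- uniformly integrable; pointwise convergence then upgrades to `L¹`.
  have hui : UniformIntegrable (fun (n : ℕ) ω => M (gridAbove n (V ω)) ω) 1 μ :=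
    ((hM.integrable (N + 1)).uniformIntegrable_condExp hm).ae_eq hae
  have hlim : ∀ᵐ ω ∂μ, Tendsto (fun n : ℕ => M (gridAbove n (V ω)) ω) atTop (𝓝 (M (V ω) ω)) :=
    ae_of_all _ fun ω => (hcont ω (V ω)).tendsto.comp (tendsto_gridAbove _)
  have hmem := hui.memLp_of_ae_tendsto hlim
  have hL1 := tendsto_Lp_finite_of_tendsto_ae le_rfl ENNReal.one_ne_top hui.1 hmem hui.2.1 hlim
  have hint : ∀ n : ℕ, Integrable (fun ω => M (gridAbove n (V ω)) ω) μ := fun n =>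
    integrable_condExp.congr (hae n)
  refine ⟨memLp_one_iff_integrable.1 hmem, ?_⟩
  refine tendsto_nhds_unique
    (tendsto_integral_of_L1' _ hmem.1 (Eventually.of_forall hint) hL1) ?_
  refine tendsto_const_nhds.congr fun n => ?_
  rw [← integral_congr_ae (hae n), integral_condExp (hm n)]

/-- Optional sampling on an event, for a vector-valued right-continuous martingale. -/
theorem setIntegral_apply_eq_of_martingale {d : ℕ} {M : ℝ≥0 → Ω → EuclideanSpace ℝ (Fin d)}
    (hM : Martingale M ℱ μ)
    (hcont : ∀ ω t, ContinuousWithinAt (fun u => M u ω) (Set.Ici t) t) {V : Ω → ℝ≥0} {G : Set Ω}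
    (hV : ∀ r, MeasurableSet[ℱ r] (G ∩ {ω | V ω < r})) {N : ℝ≥0} (hN : ∀ ω, V ω ≤ N) :
    IntegrableOn (fun ω => M (V ω) ω) G μ ∧
      ∫ ω in G, M (V ω) ω ∂μ = ∫ ω in G, M (N + 1) ω ∂μ := by
  classical
  have hG : MeasurableSet[ℱ (N + 1)] G := by
    convert hV (N + 1) using 1
    exact (Set.inter_eq_left.2 fun ω _ => (hN ω).trans_lt (lt_add_one N)).symm
  have hGm : MeasurableSet G := ℱ.le _ _ hG
  have hcoord : ∀ i, IntegrableOn (fun ω => M (V ω) ω i) G μ ∧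
      ∫ ω in G, M (V ω) ω i ∂μ = ∫ ω in G, M (N + 1) ω i ∂μ := by
    intro i
    have hMi : Martingale (fun t ω => M t ω i) ℱ μ := by
      refine martingale_of_forall_setIntegral_eq
        (fun t => (EuclideanSpace.proj i).continuous.comp_stronglyMeasurable (hM.1 t))
        (fun t => (hM.integrable t).eval_piLp i) fun s t hst A hA => ?_
      have h := hM.setIntegral_eq hst hA
      rw [← eval_integral_piLp fun i => ((hM.integrable s).eval_piLp i).integrableOn,
        ← eval_integral_piLp fun i => ((hM.integrable t).eval_piLp i).integrableOn, h]
    -- Off `G` the time is frozen at `N + 1`, so the integrals over `Gᶜ` cancel and the identity on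
    -- `G` remains.
    set W : Ω → ℝ≥0 := fun ω => if ω ∈ G then V ω else N + 1 with hW
    have hWlt : ∀ r, MeasurableSet[ℱ r] {ω | W ω < r} := by
      intro r
      have : {ω | W ω < r} = (G ∩ {ω | V ω < r}) ∪ (Gᶜ ∩ {_ω | N + 1 < r}) := by
        ext ω
        by_cases h : ω ∈ G <;> simp [hW, h]
      rw [this]
      refine MeasurableSet.union (hV r) ?_
      rcases le_or_gt r (N + 1) with hr | hr
      · simp [hr.not_gt]
      · simpa [hr] using ℱ.mono hr.le _ hG
    have hWN : ∀ ω, W ω ≤ N + 1 := fun ω => by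
      by_cases h : ω ∈ G
      · simpa [hW, h] using (hN ω).trans (by simp)
      · simp [hW, h]
    have hproj : ∀ ω t, ContinuousWithinAt (fun u => M u ω i) (Set.Ici t) t := fun ω t =>
      (EuclideanSpace.proj (𝕜 := ℝ) i).continuous.continuousAt.comp_continuousWithinAt (hcont ω t)
    obtain ⟨hint, heq⟩ := integral_apply_eq_of_martingale hMi hproj hWlt hWN
    have honG : Set.EqOn (fun ω => M (W ω) ω i) (fun ω => M (V ω) ω i) G := fun ω h => by
      simp [hW, h]
    have hoff : Set.EqOn (fun ω => M (W ω) ω i) (fun ω => M (N + 1) ω i) Gᶜ := fun ω h => by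
      simp [hW, Set.notMem_of_mem_compl h]
    refine ⟨hint.integrableOn.congr_fun honG hGm, ?_⟩
    have hN2 : ∫ ω, M (N + 1 + 1) ω i ∂μ = ∫ ω, M (N + 1) ω i ∂μ := by
      simpa using (hMi.setIntegral_eq (i := N + 1) (j := N + 1 + 1) (by simp)
        MeasurableSet.univ).symm
    rw [hN2, ← integral_add_compl hGm hint,
      ← integral_add_compl hGm (hMi.integrable (N + 1)), setIntegral_congr_fun hGm honG,
      setIntegral_congr_fun hGm.compl hoff] at heq
    exact add_right_cancel heq
  refine ⟨Integrable.of_eval_piLp fun i => (hcoord i).1, ?_⟩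
  ext i
  rw [eval_integral_piLp fun i => (hcoord i).1,
    eval_integral_piLp fun i => ((hM.integrable _).eval_piLp i).integrableOn]
  exact (hcoord i).2

end Martingales

/-! ### Disintegration by densities, and conditioning a martingale on an initial variable -/

section Disintegration

variable {α Ω : Type*} {mα : MeasurableSpace α} {m : MeasurableSpace Ω}

/-- A measure that is absolutely continuous with respect to a composition product disintegrates
along its first marginal, without any regularity of the underlying spaces. -/
theorem exists_isMarkovKernel_compProd_eq {L : Measure α} [IsFiniteMeasure L]
    {κ : Kernel α Ω} [IsMarkovKernel κ] {ν : Measure (α × Ω)} (hfst : ν.fst = L)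
    (hν : ν ≪ L ⊗ₘ κ) : ∃ η : Kernel α Ω, IsMarkovKernel η ∧ ν = L ⊗ₘ η := by
  classical
  have hνfin : IsFiniteMeasure ν := ⟨by
    rw [← Measure.fst_univ, hfst]; exact measure_lt_top _ _⟩
  set g : α → Ω → ℝ≥0 := fun a ω => (ν.rnDeriv (L ⊗ₘ κ) (a, ω)).toNNReal with hg
  have hgm : Measurable (Function.uncurry fun a ω => (g a ω : ℝ≥0∞)) := by
    simp only [hg]
    exact (Measure.measurable_rnDeriv ν (L ⊗ₘ κ)).ennreal_toNNReal.coe_nnreal_ennreal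
  set η₀ : Kernel α Ω := κ.withDensity fun a ω => g a ω with hη₀
  have h0 : L ⊗ₘ η₀ = ν := by
    rw [hη₀, Measure.compProd_withDensity hgm]
    refine Eq.trans ?_ (Measure.withDensity_rnDeriv_eq _ _ hν)
    refine withDensity_congr_ae ?_
    filter_upwards [Measure.rnDeriv_lt_top ν (L ⊗ₘ κ)] with p hp
    exact ENNReal.coe_toNNReal hp.ne
  have hmass : ∀ᵐ a ∂L, η₀ a Set.univ = 1 := by
    refine ae_eq_of_forall_setLIntegral_eq_of_sigmaFinite
      (Kernel.measurable_coe _ MeasurableSet.univ) measurable_const fun B hB _ => ?_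
    rw [← Measure.compProd_apply_prod hB MeasurableSet.univ, h0, setLIntegral_const, one_mul,
      ← hfst, Measure.fst_apply hB, Set.prod_univ]
  have hs : MeasurableSet {a | η₀ a Set.univ = 1} :=
    Kernel.measurable_coe _ MeasurableSet.univ (measurableSet_singleton 1)
  -- The density kernel has mass one only almost everywhere; on the exceptional set it is replaced
  -- by `κ`.
  refine ⟨Kernel.piecewise hs η₀ κ, ⟨fun a => ?_⟩, ?_⟩
  · rw [Kernel.piecewise_apply]
    split_ifs with h
    · exact ⟨h⟩
    · infer_instance
  · have hSF : IsSFiniteKernel η₀ := by rw [hη₀]; infer_instance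
    rw [← h0]
    refine Measure.compProd_congr ?_
    filter_upwards [hmass] with a ha
    rw [Kernel.piecewise_apply, if_pos]
    exact ha

variable {X : Type*} [NormedAddCommGroup X] {R : Measure Ω} [IsFiniteMeasure R] {X₀ : Ω → α}
  {κ : Kernel α Ω} [IsMarkovKernel κ]

theorem ae_integrable_of_map_eq_compProd (hX₀ : Measurable X₀)
    (h : R.map (fun ω => (X₀ ω, ω)) = R.map X₀ ⊗ₘ κ) {f : Ω → X} (hfm : StronglyMeasurable f)
    (hf : Integrable f R) : ∀ᵐ a ∂(R.map X₀), Integrable f (κ a) := by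
  have hpair : Measurable fun ω => (X₀ ω, ω) := hX₀.prodMk measurable_id
  have h1 : Integrable (fun p : α × Ω => f p.2) (R.map X₀ ⊗ₘ κ) := by
    rw [← h]
    exact (integrable_map_measure
      (hfm.comp_measurable measurable_snd).aestronglyMeasurable hpair.aemeasurable).2 hf
  exact (Measure.integrable_compProd_iff h1.1).1 h1 |>.1

/-- Here `h` makes `κ` the conditional law of `ω` given `X₀`, so integrating `∫ f dκ_a` over `B`
returns the integral of `f` over `X₀⁻¹ B`. -/
theorem ae_integral_eq_zero_of_map_eq_compProd [NormedSpace ℝ X] [CompleteSpace X]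
    (hX₀ : Measurable X₀)
    (h : R.map (fun ω => (X₀ ω, ω)) = R.map X₀ ⊗ₘ κ) {f : Ω → X} (hfm : StronglyMeasurable f)
    (hf : Integrable f R) (hzero : ∀ B, MeasurableSet B → ∫ ω in (X₀ ⁻¹' B), f ω ∂(R) = 0) :
    ∀ᵐ a ∂(R.map X₀), ∫ ω, f ω ∂(κ a) = 0 := by
  have hpair : Measurable fun ω => (X₀ ω, ω) := hX₀.prodMk measurable_id
  have h1 : Integrable (fun p : α × Ω => f p.2) (R.map X₀ ⊗ₘ κ) := by
    rw [← h]
    exact (integrable_map_measure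
      (hfm.comp_measurable measurable_snd).aestronglyMeasurable hpair.aemeasurable).2 hf
  refine ae_eq_zero_of_forall_setIntegral_eq_of_sigmaFinite
    (fun B _ _ => h1.integral_compProd.integrableOn) fun B hB _ => ?_
  have h2 := Measure.setIntegral_compProd hB MeasurableSet.univ
    (h1.integrableOn (s := B ×ˢ Set.univ))
  simp only [Measure.restrict_univ] at h2
  have h3 := setIntegral_map (hB.prod MeasurableSet.univ)
    (hfm.comp_measurable measurable_snd).aestronglyMeasurable hpair.aemeasurable (μ := R)
  simp only [Function.comp_apply] at h3
  rw [← h2, ← h, h3]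
  convert hzero B hB using 3
  ext ω
  simp

theorem exists_countable_isPiSystem (h : MeasurableSpace.CountablyGenerated Ω) :
    ∃ C : Set (Set Ω), C.Countable ∧ IsPiSystem C ∧ Set.univ ∈ C ∧
      m = MeasurableSpace.generateFrom C := by
  obtain ⟨b, hb, hm⟩ := h.1
  -- Finite intersections of generators; the empty one supplies `univ`, needed later to handle
  -- complements.
  refine ⟨Set.sInter '' {t | t.Finite ∧ t ⊆ b}, (Set.countable_ofPred_finite_subset hb).image _,
    ?_, ⟨∅, by simp, by simp⟩, le_antisymm ?_ ?_⟩
  · rintro _ ⟨s, hs, rfl⟩ _ ⟨t, ht, rfl⟩ _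
    exact ⟨s ∪ t, ⟨hs.1.union ht.1, Set.union_subset hs.2 ht.2⟩, Set.sInter_union s t⟩
  · nth_rw 1 [hm]
    refine MeasurableSpace.generateFrom_mono fun s hs => ⟨{s}, by simpa using hs, by simp⟩
  · refine MeasurableSpace.generateFrom_le ?_
    rintro _ ⟨t, ht, rfl⟩
    refine MeasurableSet.sInter ht.1.countable fun s hs => ?_
    rw [hm]
    exact MeasurableSpace.measurableSet_generateFrom (ht.2 hs)

theorem setIntegral_eq_zero_of_generateFrom [NormedSpace ℝ X] {μ : Measure Ω} {f : Ω → X}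
    (hf : Integrable f μ) {m' : MeasurableSpace Ω} (hm' : m' ≤ m) {C : Set (Set Ω)}
    (hC : IsPiSystem C) (huniv : Set.univ ∈ C) (hgen : m' = MeasurableSpace.generateFrom C)
    (hzero : ∀ A ∈ C, ∫ ω in A, f ω ∂μ = 0) {A : Set Ω} (hA : MeasurableSet[m'] A) :
    ∫ ω in A, f ω ∂μ = 0 := by
  have htot : ∫ ω, f ω ∂μ = 0 := by simpa using hzero _ huniv
  induction A, hA using MeasurableSpace.induction_on_inter hgen hC with
  | empty => simp
  | basic A hA => exact hzero A hA
  | compl A hA ih =>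
    have := integral_add_compl (hm' _ hA) hf
    rwa [ih, zero_add, htot] at this
  | iUnion A hd hA ih =>
    rw [integral_iUnion (fun i => hm' _ (hA i)) hd hf.integrableOn]
    simp [ih]

/-- The conditional laws given an initial variable of a right-continuous martingale are again
martingale laws, for a filtration of countably generated `σ`-algebras. -/
theorem ae_martingale_of_map_eq_compProd [NormedSpace ℝ X] [CompleteSpace X]
    {ℱ : Filtration ℝ≥0 m}
    (hgen : ∀ s, @MeasurableSpace.CountablyGenerated Ω (ℱ s)) (hX₀ : Measurable[ℱ 0] X₀)
    (h : R.map (fun ω => (X₀ ω, ω)) = R.map X₀ ⊗ₘ κ) {M : ℝ≥0 → Ω → X} (hM : Martingale M ℱ R)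
    (hcont : ∀ ω t, ContinuousWithinAt (fun u => M u ω) (Set.Ici t) t) {c : ℝ}
    (hbd : ∀ s t ω, s ≤ t → ‖M s ω‖ ≤ c + ‖M t ω‖) :
    ∀ᵐ a ∂(R.map X₀), Martingale M ℱ (κ a) := by
  obtain ⟨D, hDc, hD⟩ := TopologicalSpace.exists_countable_dense ℝ≥0
  choose C hCc hCpi hCu hCgen using fun s => @exists_countable_isPiSystem Ω (ℱ s) (hgen s)
  have hX₀m : Measurable X₀ := hX₀.mono (ℱ.le 0) le_rfl
  have hMm : ∀ t, StronglyMeasurable (M t) := fun t => (hM.1 t).mono (ℱ.le t)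
  have hCm : ∀ s, ∀ A ∈ C s, MeasurableSet[ℱ s] A := fun s A hA => by
    rw [hCgen s]; exact MeasurableSpace.measurableSet_generateFrom hA
  have h1 : ∀ᵐ a ∂(R.map X₀), ∀ n : ℕ, Integrable (M n) (κ a) :=
    ae_all_iff.2 fun n => ae_integrable_of_map_eq_compProd hX₀m h (hMm n) (hM.integrable n)
  have h2 : ∀ᵐ a ∂(R.map X₀), ∀ s ∈ D, ∀ t ∈ D, s ≤ t → ∀ A ∈ C s,
      ∫ ω in A, (M t ω - M s ω) ∂(κ a) = 0 := by
    refine (ae_ball_iff hDc).2 fun s hs => (ae_ball_iff hDc).2 fun t ht =>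
      eventually_imp_distrib_left.2 fun hst => (ae_ball_iff (hCc s)).2 fun A hA => ?_
    have hAm := hCm s A hA
    have hAm' := ℱ.le s _ hAm
    simp only [← integral_indicator hAm']
    refine ae_integral_eq_zero_of_map_eq_compProd hX₀m h
      (((hMm t).sub (hMm s)).indicator hAm')
      (((hM.integrable t).sub (hM.integrable s)).indicator hAm') fun B hB => ?_
    -- As `X₀` is known at time `0`, intersecting `A` with an event of `X₀` stays in `ℱ s`, where
    -- the martingale identity under `R` applies.
    have hB' : MeasurableSet[ℱ s] (X₀ ⁻¹' B) := ℱ.mono (zero_le (a := s)) _ (hX₀ hB)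
    rw [setIntegral_indicator hAm', integral_sub (hM.integrable t).integrableOn
      (hM.integrable s).integrableOn, hM.setIntegral_eq hst (hB'.inter hAm), sub_self]
  filter_upwards [h1, h2] with a ha1 ha2
  -- The bound `hbd` deduces integrability at every time from that at integer times.
  have hint : ∀ t, Integrable (M t) (κ a) := fun t => by
    obtain ⟨n, hn⟩ := exists_nat_ge t
    exact ((integrable_const c).add (ha1 n).norm).mono' (hMm t).aestronglyMeasurable
      (ae_of_all _ fun ω => hbd t n ω hn)
  refine martingale_of_forall_setIntegral_eq hM.1 hint fun s t hst A hA => ?_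
  rcases hst.eq_or_lt with rfl | hst
  · rfl
  -- Dense times `q k → s` and `p k → t` from the right satisfy `q k < t < p k`, and `A` belongs to
  -- `ℱ (q k)`. All values are dominated by `c + ‖M (t + 1)‖`.
  obtain ⟨q, hq, hqlim⟩ := exists_seq_dense_tendsto_right hD hst
  obtain ⟨p, hp, hplim⟩ := exists_seq_dense_tendsto_right hD (lt_add_one t)
  have hlim : ∀ (v : ℕ → ℝ≥0) (r : ℝ≥0), (∀ k, v k ≤ t + 1) → Tendsto v atTop (𝓝[≥] r) →
      Tendsto (fun k => ∫ ω in A, M (v k) ω ∂(κ a)) atTop (𝓝 (∫ ω in A, M r ω ∂(κ a))) := by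
    intro v r hv hvlim
    refine tendsto_integral_of_dominated_convergence (fun ω => c + ‖M (t + 1) ω‖)
      (fun k => (hMm _).aestronglyMeasurable)
      ((integrable_const c).add (hint (t + 1)).norm).integrableOn
      (fun k => ae_of_all _ fun ω => hbd _ _ ω (hv k))
      (ae_of_all _ fun ω => (hcont ω r).tendsto.comp hvlim)
  refine tendsto_nhds_unique (hlim q s (fun k => ?_) hqlim)
    ((hlim p t (fun k => (hp k).2.2.le) hplim).congr fun k => ?_)
  · exact (hq k).2.2.le.trans (by simp)
  · have hqp : q k ≤ p k := ((hq k).2.2.trans (hp k).2.1).le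
    have := setIntegral_eq_zero_of_generateFrom (m := m) ((hint (p k)).sub (hint (q k)))
      (ℱ.le (q k)) (hCpi _) (hCu _) (hCgen _)
      (ha2 (q k) (hq k).1 (p k) (hp k).1 hqp) (ℱ.mono (hq k).2.1.le _ hA)
    simp only [Pi.sub_apply] at this
    rw [integral_sub (hint _).integrableOn (hint _).integrableOn, sub_eq_zero] at this
    exact this

end Disintegration

/-! ### The strong Markov property as a disintegration -/

section StrongMarkov

variable {E : Type*} [TopologicalSpace E] [MeasurableSpace E]

theorem measurable_of_isStoppingTime_rightFiltration {τ : PathSpace E → ℝ≥0}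
    (hτ : IsStoppingTime (rightFiltration E) (fun ω => (τ ω : WithTop ℝ≥0))) : Measurable τ :=
  measurable_of_Iio fun r => (rawFiltration E).le r _
    (measurableSet_lt_of_isStoppingTime_rightFiltration hτ r)

variable [TopologicalSpace.PseudoMetrizableSpace E] [BorelSpace E]

/-- The strong Markov property in terms of the joint law of `X_τ` and `θ_τ`. -/
theorem IsCanonicalStrongMarkov.isRegularCondDistrib {P : Kernel E (PathSpace E)}
    (hP : IsCanonicalStrongMarkov P) {τ : PathSpace E → ℝ≥0} (hτ : τ ∈ boundedStoppingTimes E)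
    (x : E) : IsRegularCondDistrib (P x) τ P := by
  have := hP.isMarkovKernel
  refine ⟨this, ?_⟩
  have hτm := measurable_of_isStoppingTime_rightFiltration hτ.1
  have hX := measurable_coordAt hτm
  have hθ := measurable_shiftAt hτm
  have hmapfin : IsProbabilityMeasure ((P x).map (coordAt τ)) :=
    Measure.isProbabilityMeasure_map hX.aemeasurable
  have hmapfin2 : IsProbabilityMeasure
      ((P x).map fun ω => (coordAt τ ω, shiftAt τ ω)) :=
    Measure.isProbabilityMeasure_map (hX.prodMk hθ).aemeasurable
  refine Measure.ext_prod fun {B C} hB hC => ?_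
  rw [Measure.map_apply (hX.prodMk hθ) (hB.prod hC), Measure.compProd_apply_prod hB hC,
    setLIntegral_map hB (Kernel.measurable_coe P hC) hX, ← lintegral_indicator (hX hB)]
  have hK : MeasurableSet (coord 0 ⁻¹' B ∩ C) := (measurable_coord 0 hB).inter hC
  -- Since the shifted path starts at `X_τ`, the rectangle `B ×ˢ C` is an event of `θ_τ` alone.
  -- Under `P y` the first condition is just `y ∈ B`.
  set Z : PathSpace E → ℝ := (coord 0 ⁻¹' B ∩ C).indicator 1 with hZ
  have hZm : Measurable Z := measurable_one.indicator hK
  have hZb : ∀ ω, |Z ω| ≤ 1 := fun ω => by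
    simp only [hZ, Set.indicator]; split_ifs <;> simp
  have hle := hτ.1.measurableSpace_le
  have hcond := integral_congr_ae (hP.strongMarkov τ hτ.1 hτ.2 x Z hZm ⟨1, hZb⟩)
  rw [integral_condExp hle] at hcond
  have hinner : ∀ y, ∫ ω', Z ω' ∂(P y) = (B.indicator (fun y => P y C) y).toReal := by
    intro y
    rw [hZ, integral_indicator_one hK, Measure.real]
    congr 1
    by_cases hy : y ∈ B
    · rw [Set.indicator_of_mem hy]
      refine measure_congr ?_
      filter_upwards [hP.start y] with ω hω
      refine propext ⟨fun h => h.2, fun h => ⟨?_, h⟩⟩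
      simpa [hω] using hy
    · rw [Set.indicator_of_notMem hy]
      refine measure_mono_null Set.inter_subset_left ?_
      refine measure_mono_null ?_ (ae_iff.1 (hP.start y))
      intro ω hω h
      exact hy (h ▸ hω)
  have hleft : ∫ ω, Z (shiftAt τ ω) ∂(P x) =
      ((P x) ((fun ω => (coordAt τ ω, shiftAt τ ω)) ⁻¹' B ×ˢ C)).toReal := by
    rw [← Measure.real, ← integral_indicator_one ((hX.prodMk hθ) (hB.prod hC))]
    refine integral_congr_ae (ae_of_all _ fun ω => ?_)
    have hiff : shiftAt τ ω ∈ coord 0 ⁻¹' B ∩ C ↔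
        ω ∈ (fun ω => (coordAt τ ω, shiftAt τ ω)) ⁻¹' B ×ˢ C := by
      rw [Set.mem_inter_iff, Set.mem_preimage, coord_zero_shiftAt]
      exact Iff.rfl
    by_cases h : shiftAt τ ω ∈ coord 0 ⁻¹' B ∩ C
    · simp only [hZ]
      rw [Set.indicator_of_mem h, Set.indicator_of_mem (hiff.1 h)]; rfl
    · simp only [hZ]
      rw [Set.indicator_of_notMem h, Set.indicator_of_notMem (mt hiff.2 h)]
  rw [hleft] at hcond
  simp only [hinner] at hcond
  have hmeas : Measurable fun ω => B.indicator (fun y => P y C) (coordAt τ ω) :=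
    ((Kernel.measurable_coe P hC).indicator hB).comp hX
  have hle1 : ∀ y, B.indicator (fun y => P y C) y ≤ 1 := fun y =>
    (Set.indicator_le_self _ _ y).trans prob_le_one
  rw [integral_toReal hmeas.aemeasurable
    (ae_of_all _ fun ω => (hle1 _).trans_lt ENNReal.one_lt_top)] at hcond
  have hfin : ∫⁻ ω, B.indicator (fun y => P y C) (coordAt τ ω) ∂(P x) ≠ ∞ := by
    refine ((lintegral_mono fun ω => hle1 (coordAt τ ω)).trans_lt ?_).ne
    simp
  exact (ENNReal.toReal_eq_toReal_iff' (measure_ne_top _ _) hfin).1 hcond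

end StrongMarkov

/-! ### Capped times and local boundedness of paths -/

section StoppedPaths

/-- The finite time `min u ρ`. -/
noncomputable def capTime (ρ : WithTop ℝ≥0) (u : ℝ≥0) : ℝ≥0 := (min (u : WithTop ℝ≥0) ρ).untopA

theorem coe_capTime (ρ : WithTop ℝ≥0) (u : ℝ≥0) :
    (capTime ρ u : WithTop ℝ≥0) = min (u : WithTop ℝ≥0) ρ := by
  obtain ⟨r, hr⟩ := WithTop.ne_top_iff_exists.1
    ((min_le_left _ ρ).trans_lt (WithTop.coe_lt_top u)).ne
  rw [capTime, ← hr]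
  rfl

theorem capTime_le (ρ : WithTop ℝ≥0) (u : ℝ≥0) : capTime ρ u ≤ u :=
  WithTop.coe_le_coe.1 ((coe_capTime ρ u).le.trans (min_le_left _ _))

theorem capTime_of_le {ρ : WithTop ℝ≥0} {u : ℝ≥0} (h : (u : WithTop ℝ≥0) ≤ ρ) :
    capTime ρ u = u :=
  WithTop.coe_injective ((coe_capTime ρ u).trans (min_eq_left h))

theorem coe_capTime_of_ge {ρ : WithTop ℝ≥0} {u : ℝ≥0} (h : ρ ≤ (u : WithTop ℝ≥0)) :
    (capTime ρ u : WithTop ℝ≥0) = ρ :=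
  (coe_capTime ρ u).trans (min_eq_right h)

theorem capTime_lt_iff {ρ : WithTop ℝ≥0} {u r : ℝ≥0} :
    capTime ρ u < r ↔ u < r ∨ ρ < (r : WithTop ℝ≥0) := by
  rw [← WithTop.coe_lt_coe, coe_capTime, min_lt_iff, WithTop.coe_lt_coe]

theorem le_capTime_iff {ρ : WithTop ℝ≥0} {u r : ℝ≥0} :
    r ≤ capTime ρ u ↔ r ≤ u ∧ (r : WithTop ℝ≥0) ≤ ρ := by
  rw [← WithTop.coe_le_coe, coe_capTime, le_min_iff, WithTop.coe_le_coe]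

theorem capTime_eq_capTime_of_le {ρ : WithTop ℝ≥0} {s t : ℝ≥0} (hst : s ≤ t)
    (h : ρ ≤ (s : WithTop ℝ≥0)) : capTime ρ s = capTime ρ t :=
  WithTop.coe_injective ((coe_capTime_of_ge h).trans
    (coe_capTime_of_ge (h.trans (WithTop.coe_le_coe.2 hst))).symm)

theorem continuousWithinAt_apply_capTime {X : Type*} [TopologicalSpace X] {w : ℝ≥0 → X}
    (hw : ∀ t, ContinuousWithinAt w (Set.Ici t) t) (ρ : WithTop ℝ≥0) (t : ℝ≥0) :
    ContinuousWithinAt (fun u => w (capTime ρ u)) (Set.Ici t) t := by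
  induction ρ using WithTop.recTopCoe with
  | top => simpa only [capTime_of_le (le_top : ((_ : ℝ≥0) : WithTop ℝ≥0) ≤ ⊤)] using hw t
  | coe r =>
    have h : ∀ u : ℝ≥0, capTime (r : WithTop ℝ≥0) u = min u r := fun u =>
      WithTop.coe_injective ((coe_capTime _ u).trans (WithTop.coe_min u r).symm)
    simp only [h]
    refine (hw (min t r)).comp (f := fun u => min u r) (by fun_prop) fun u hu => ?_
    exact min_le_min_right r hu

/-- An RCLL path in a normed space is bounded on bounded time intervals. -/
theorem IsRCLL.exists_norm_le {X : Type*} [NormedAddCommGroup X] {w : ℝ≥0 → X} (hw : IsRCLL w)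
    (t : ℝ≥0) : ∃ C, ∀ u ≤ t, ‖w u‖ ≤ C := by
  have hcompact : IsCompact (Set.Icc 0 t) := isCompact_Icc
  have : ∃ C, ∀ u ∈ Set.Icc 0 t, ‖w u‖ ≤ C := by
    refine hcompact.induction_on (p := fun s => ∃ C, ∀ u ∈ s, ‖w u‖ ≤ C) ⟨0, by simp⟩ ?_ ?_ ?_
    · rintro s s' hss ⟨C, hC⟩
      exact ⟨C, fun u hu => hC u (hss hu)⟩
    · rintro s s' ⟨C, hC⟩ ⟨C', hC'⟩
      refine ⟨max C C', fun u hu => ?_⟩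
      rcases hu with hu | hu
      · exact (hC u hu).trans (le_max_left _ _)
      · exact (hC' u hu).trans (le_max_right _ _)
    · intro u _
      obtain ⟨l, hl⟩ := hw.2 u
      have h1 : ∀ᶠ v in 𝓝[<] u, ‖w v‖ ≤ ‖l‖ + 1 :=
        (hl.norm.eventually_lt_const (lt_add_one _)).mono fun _ h => h.le
      have h2 : ∀ᶠ v in 𝓝[≥] u, ‖w v‖ ≤ ‖w u‖ + 1 :=
        ((hw.1 u).tendsto.norm.eventually_lt_const (lt_add_one _)).mono fun _ h => h.le
      refine ⟨{v | ‖w v‖ ≤ max (‖l‖ + 1) (‖w u‖ + 1)}, mem_nhdsWithin_of_mem_nhds ?_,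
        _, fun v hv => hv⟩
      rw [← nhdsLT_sup_nhdsGE]
      exact ⟨h1.mono fun v hv => hv.trans (le_max_left _ _),
        h2.mono fun v hv => hv.trans (le_max_right _ _)⟩
  obtain ⟨C, hC⟩ := this
  exact ⟨C, fun u hu => hC u ⟨zero_le, hu⟩⟩

end StoppedPaths

/-! ### Level times of the running supremum -/

section PriceLevel

variable {d : ℕ} {F : Type*} [TopologicalSpace F]

theorem isRCLL_price (ω : PathSpace (State d F)) : IsRCLL fun t => price t ω := by
  have hc : Continuous fun x : State d F => x.2.1 := by fun_prop
  refine ⟨fun t => hc.continuousAt.comp_continuousWithinAt (ω.2.1 t), fun t => ?_⟩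
  obtain ⟨l, hl⟩ := ω.2.2 t
  exact ⟨l.2.1, (hc.tendsto l).comp hl⟩

/-- The running supremum of the norm of the price process. -/
noncomputable def runningSup (t : ℝ≥0) (ω : PathSpace (State d F)) : ℝ≥0∞ :=
  ⨆ u ≤ t, ‖price u ω‖ₑ

theorem enorm_price_le_runningSup {u t : ℝ≥0} (h : u ≤ t) (ω : PathSpace (State d F)) :
    ‖price u ω‖ₑ ≤ runningSup t ω :=
  le_iSup₂_of_le (f := fun u (_ : u ≤ t) => ‖price u ω‖ₑ) u h le_rfl

theorem runningSup_lt_top (t : ℝ≥0) (ω : PathSpace (State d F)) : runningSup t ω < ∞ := by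
  obtain ⟨C, hC⟩ := (isRCLL_price ω).exists_norm_le t
  refine lt_of_le_of_lt (iSup₂_le fun u hu => ?_) (ENNReal.ofReal_lt_top (r := C))
  rw [← ofReal_norm]
  exact ENNReal.ofReal_le_ofReal (hC u hu)

theorem runningSup_eq_iSup_dense {D : Set ℝ≥0} (hD : Dense D) (t : ℝ≥0)
    (ω : PathSpace (State d F)) :
    runningSup t ω = ⨆ q ∈ insert t (D ∩ Set.Iio t), ‖price q ω‖ₑ := by
  refine le_antisymm (iSup₂_le fun u hu => ?_) (iSup₂_le fun q hq => ?_)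
  · rcases hu.eq_or_lt with rfl | hu
    · exact le_iSup₂_of_le u (Set.mem_insert _ _) le_rfl
    · refine mem_of_isClosed_of_forall_dense (isRCLL_price ω).1
        (C := {y | ‖y‖ₑ ≤ ⨆ q ∈ insert t (D ∩ Set.Iio t), ‖price q ω‖ₑ})
        (isClosed_le continuous_enorm continuous_const) hD hu fun q hq _ hqt => ?_
      exact le_iSup₂_of_le (f := fun q (_ : q ∈ insert t (D ∩ Set.Iio t)) => ‖price q ω‖ₑ) q
        (Set.mem_insert_of_mem _ ⟨hq, hqt⟩) le_rfl
  · refine enorm_price_le_runningSup ?_ ω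
    rcases hq with rfl | hq
    · rfl
    · exact hq.2.le

/-- The first time at which the running supremum of the norm of the price reaches `n`. -/
noncomputable def priceLevelTime (n : ℕ) (ω : PathSpace (State d F)) : WithTop ℝ≥0 :=
  ⨅ t ∈ {t : ℝ≥0 | (n : ℝ≥0∞) ≤ runningSup t ω}, (t : WithTop ℝ≥0)

/-- The running supremum is right-continuous, so the infimum is attained when finite. Together with
the countable form of the supremum this makes the level time a stopping time of the raw filtration.
-/
theorem priceLevelTime_le_iff {n : ℕ} {ω : PathSpace (State d F)} {t : ℝ≥0} :
    priceLevelTime n ω ≤ t ↔ (n : ℝ≥0∞) ≤ runningSup t ω := by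
  refine ⟨fun h => ?_, fun h => iInf₂_le (f := fun (t : ℝ≥0)
    (_ : t ∈ {t : ℝ≥0 | (n : ℝ≥0∞) ≤ runningSup t ω}) => (t : WithTop ℝ≥0)) t h⟩
  by_contra! hlt
  obtain ⟨c, hc1, hc2⟩ := exists_between hlt
  have hev : ∀ᶠ u in 𝓝[≥] t, ‖price u ω‖ₑ < c :=
    ((isRCLL_price ω).1 t).enorm.eventually_lt_const
      ((enorm_price_le_runningSup le_rfl ω).trans_lt hc1)
  obtain ⟨v, hv, hsub⟩ := (mem_nhdsGE_iff_exists_Ico_subset).1 hev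
  have hv' : priceLevelTime n ω < (v : WithTop ℝ≥0) := h.trans_lt (WithTop.coe_lt_coe.2 hv)
  simp only [priceLevelTime, iInf_lt_iff, WithTop.coe_lt_coe] at hv'
  obtain ⟨r, hr, hrv⟩ := hv'
  refine (hr.trans (iSup₂_le fun u hu => ?_)).not_gt hc2
  rcases le_total u t with hut | hut
  · exact (enorm_price_le_runningSup hut ω).trans hc1.le
  · exact (hsub ⟨hut, hu.trans_lt hrv⟩ : ‖price u ω‖ₑ < c).le

theorem norm_price_lt_of_lt_priceLevelTime {n : ℕ} {ω : PathSpace (State d F)} {t : ℝ≥0}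
    (h : (t : WithTop ℝ≥0) < priceLevelTime n ω) : ‖price t ω‖ < n := by
  have h1 : runningSup t ω < n := by
    by_contra! hn
    exact (priceLevelTime_le_iff.2 hn).not_gt h
  have h2 := (enorm_price_le_runningSup le_rfl ω).trans_lt h1
  rw [← ofReal_norm, ← ENNReal.ofReal_natCast] at h2
  exact (ENNReal.ofReal_lt_ofReal_iff').1 h2 |>.1

/-- Lets lower bounds on the price stopped at `priceExit` pass to the level time. The inequality can
be strict: a left limit may reach norm `n` with no value doing so. -/
theorem priceLevelTime_le_priceExit (n : ℕ) (ω : PathSpace (State d F)) :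
    priceLevelTime n ω ≤ priceExit n ω := by
  classical
  rw [priceExit, hittingAfter_def]
  dsimp only
  split_ifs with h
  · have hle : ∀ j ∈ {i : ℝ≥0 | 0 ≤ i ∧ price i ω ∈ {s | (n : ℝ) ≤ ‖s‖}},
        priceLevelTime n ω ≤ (j : WithTop ℝ≥0) := by
      intro j hj
      refine priceLevelTime_le_iff.2 (le_trans ?_ (enorm_price_le_runningSup le_rfl ω))
      rw [← ofReal_norm, ← ENNReal.ofReal_natCast]
      exact ENNReal.ofReal_le_ofReal hj.2
    obtain ⟨j, hj⟩ := h
    obtain ⟨s, hs⟩ := WithTop.ne_top_iff_exists.1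
      ((hle j hj).trans_lt (WithTop.coe_lt_top j)).ne
    rw [← hs] at hle ⊢
    exact WithTop.coe_le_coe.2 (le_csInf ⟨j, hj⟩ fun i hi => WithTop.coe_le_coe.1 (hle i hi))
  · exact le_top

theorem priceLevelTime_mono (ω : PathSpace (State d F)) :
    Monotone fun n => priceLevelTime n ω := by
  intro n k hnk
  exact biInf_mono fun t ht => (Nat.cast_le.2 hnk).trans (Set.mem_ofPred_eq.mp ht)

theorem tendsto_priceLevelTime (ω : PathSpace (State d F)) :
    Tendsto (fun n => priceLevelTime n ω) atTop (𝓝 ⊤) := by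
  rw [WithTop.tendsto_nhds_top_iff]
  intro t
  obtain ⟨n, hn⟩ := ENNReal.exists_nat_gt (runningSup_lt_top t ω).ne
  filter_upwards [eventually_ge_atTop n] with k hk
  refine lt_of_not_ge fun h => ?_
  exact ((Nat.cast_le.2 hk).trans (priceLevelTime_le_iff.1 h)).not_gt hn

/-- The price stopped at `ρ`, set to zero on `{ρ = 0}`. -/
noncomputable def stoppedPrice (ρ : PathSpace (State d F) → WithTop ℝ≥0) :
    ℝ≥0 → PathSpace (State d F) → EuclideanSpace ℝ (Fin d) :=
  stoppedProcess (fun t => {ω | ⊥ < ρ ω}.indicator (price t)) ρ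

theorem stoppedPrice_of_pos {ρ : PathSpace (State d F) → WithTop ℝ≥0}
    {ω : PathSpace (State d F)} (h : ⊥ < ρ ω) (t : ℝ≥0) :
    stoppedPrice ρ t ω = price (capTime (ρ ω) t) ω :=
  Set.indicator_of_mem (s := {ω | ⊥ < ρ ω}) h _

theorem stoppedPrice_of_not_pos {ρ : PathSpace (State d F) → WithTop ℝ≥0}
    {ω : PathSpace (State d F)} (h : ¬ ⊥ < ρ ω) (t : ℝ≥0) : stoppedPrice ρ t ω = 0 :=
  Set.indicator_of_notMem (s := {ω | ⊥ < ρ ω}) h _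

theorem continuousWithinAt_stoppedPrice (ρ : PathSpace (State d F) → WithTop ℝ≥0)
    (ω : PathSpace (State d F)) (t : ℝ≥0) :
    ContinuousWithinAt (fun u => stoppedPrice ρ u ω) (Set.Ici t) t := by
  by_cases h : ⊥ < ρ ω
  · simp only [stoppedPrice_of_pos h]
    exact continuousWithinAt_apply_capTime (isRCLL_price ω).1 _ t
  · simp only [stoppedPrice_of_not_pos h]
    exact continuousWithinAt_const

/-- Either stopping has not occurred by `s` and the norm is below `n`, or both values coincide. The
jump at the level time may be unbounded, so the later value has to appear; this is the domination
used in the limits below. -/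
theorem norm_stoppedPrice_priceLevelTime_le (n : ℕ) (s t : ℝ≥0) (ω : PathSpace (State d F))
    (hst : s ≤ t) :
    ‖stoppedPrice (priceLevelTime n) s ω‖ ≤ n + ‖stoppedPrice (priceLevelTime n) t ω‖ := by
  by_cases h : ⊥ < priceLevelTime n ω
  · simp only [stoppedPrice_of_pos h]
    rcases lt_or_ge (s : WithTop ℝ≥0) (priceLevelTime n ω) with hs | hs
    · rw [capTime_of_le hs.le]
      exact (norm_price_lt_of_lt_priceLevelTime hs).le.trans (by simp)
    · rw [capTime_eq_capTime_of_le hst hs]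
      simp
  · simp only [stoppedPrice_of_not_pos h]
    simp

variable [MeasurableSpace F]

theorem measurable_price_rawFiltration {u s : ℝ≥0} (h : u ≤ s) :
    Measurable[rawFiltration (State d F) s] (price u : PathSpace (State d F) → _) :=
  (measurable_fst.comp measurable_snd).comp (measurable_coord_rawFiltration h)

theorem stronglyAdapted_stoppedPrice {ρ : PathSpace (State d F) → WithTop ℝ≥0}
    (hρ : IsStoppingTime (rawFiltration (State d F)) ρ) :
    StronglyAdapted (rawFiltration (State d F)) (stoppedPrice ρ) := by
  intro t
  have hlt : ∀ q ≤ t, MeasurableSet[rawFiltration (State d F) t] {ω | ρ ω < (q : ℝ≥0)} :=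
    fun q hq => (rawFiltration _).mono hq _ (hρ.measurableSet_lt q)
  have hcap : Measurable[rawFiltration (State d F) t] fun ω => capTime (ρ ω) t := by
    refine @measurable_of_Iio _ _ _ _ _ (rawFiltration _ t) _ _ _ _ fun q => ?_
    have : (fun ω => capTime (ρ ω) t) ⁻¹' Set.Iio q = {ω | t < q ∨ ρ ω < q} := by
      ext ω; simp [capTime_lt_iff]
    rw [this]
    rcases le_or_gt q t with hq | hq
    · simpa [hq.not_gt] using hlt q hq
    · simp [hq]
  have hprice : Measurable[rawFiltration (State d F) t]
      fun ω : PathSpace (State d F) => price (capTime (ρ ω) t) ω :=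
    @measurable_apply_of_rightContinuous _ _ _ _ _ _ (rawFiltration _ t) _ t
      (fun ω => (isRCLL_price ω).1) (fun u hu => measurable_price_rawFiltration hu) _ hcap
      fun ω => capTime_le _ _
  have hpos : MeasurableSet[rawFiltration (State d F) t] {ω | ⊥ < ρ ω} := by
    have h0 := (rawFiltration (State d F)).mono (zero_le (a := t)) _ (hρ 0).compl
    convert h0 using 1
    ext ω
    simp [pos_iff_ne_zero]
  exact (hprice.indicator hpos).stronglyMeasurable

theorem isStoppingTime_priceLevelTime (n : ℕ) :
    IsStoppingTime (rawFiltration (State d F)) (priceLevelTime n) := by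
  intro t
  simp only [priceLevelTime_le_iff]
  obtain ⟨D, hDc, hD⟩ := TopologicalSpace.exists_countable_dense ℝ≥0
  have hmeas : Measurable[rawFiltration (State d F) t]
      (fun ω : PathSpace (State d F) => runningSup t ω) := by
    simp only [runningSup_eq_iSup_dense hD]
    refine @Measurable.biSup _ _ _ _ _ (rawFiltration _ t) _ _ _ _ _ _
      ((hDc.mono Set.inter_subset_left).insert t) fun q hq => ?_
    refine measurable_enorm.comp (measurable_price_rawFiltration ?_)
    rcases hq with rfl | hq
    · rfl
    · exact hq.2.le
  exact @measurableSet_le _ _ _ _ _ (rawFiltration _ t) _ _ _ _ _ measurable_const hmeas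

theorem measurableSet_lt_priceLevelTime (n : ℕ) (s : ℝ≥0) :
    MeasurableSet[rawFiltration (State d F) s]
      {ω : PathSpace (State d F) | (s : WithTop ℝ≥0) < priceLevelTime n ω} := by
  have h : MeasurableSet[rawFiltration (State d F) s]
      {ω : PathSpace (State d F) | priceLevelTime n ω ≤ (s : WithTop ℝ≥0)}ᶜ :=
    (isStoppingTime_priceLevelTime n s).compl
  simpa only [Set.compl_ofPred, not_le] using h

end PriceLevel

/-! ### The stopped price after time `τ` is a martingale -/

section ShiftedMartingale

variable {d : ℕ} {F : Type*} [TopologicalSpace F]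

/-- The time `τ + min t (σ_n ∘ θ_τ)`. -/
noncomputable def shiftedLevelTime (τ : PathSpace (State d F) → ℝ≥0) (n : ℕ) (t : ℝ≥0)
    (ω : PathSpace (State d F)) : ℝ≥0 :=
  τ ω + capTime (priceLevelTime n (shiftAt τ ω)) t

theorem shiftedLevelTime_le {τ : PathSpace (State d F) → ℝ≥0} {N : ℝ≥0} (hN : ∀ ω, τ ω ≤ N)
    (n : ℕ) {t T : ℝ≥0} (htT : t ≤ T) (ω : PathSpace (State d F)) :
    shiftedLevelTime τ n t ω ≤ N + T :=
  add_le_add (hN ω) ((capTime_le _ _).trans htT)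

theorem stoppedPrice_shiftAt {τ : PathSpace (State d F) → ℝ≥0} {n : ℕ}
    {ω : PathSpace (State d F)} (h : ⊥ < priceLevelTime n (shiftAt τ ω)) (t : ℝ≥0) :
    stoppedPrice (priceLevelTime n) t (shiftAt τ ω) = price (shiftedLevelTime τ n t ω) ω :=
  stoppedPrice_of_pos h t

/-- Capping at `ρ` only replaces `t` by an earlier time of the shifted stopped path, so bounds for
that path apply uniformly in the localizing times. -/
theorem exists_price_capTime_shiftedLevelTime_eq {τ : PathSpace (State d F) → ℝ≥0} {n : ℕ}
    {ω : PathSpace (State d F)} (h : ⊥ < priceLevelTime n (shiftAt τ ω)) {ρ : WithTop ℝ≥0}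
    (hρ : (τ ω : WithTop ℝ≥0) < ρ) (t : ℝ≥0) :
    ∃ u ≤ t, price (capTime ρ (shiftedLevelTime τ n t ω)) ω =
      stoppedPrice (priceLevelTime n) u (shiftAt τ ω) := by
  set r := capTime ρ (shiftedLevelTime τ n t ω) with hr
  have hτr : τ ω ≤ r := le_capTime_iff.2 ⟨le_self_add, hρ.le⟩
  have hrc : r - τ ω ≤ capTime (priceLevelTime n (shiftAt τ ω)) t :=
    tsub_le_iff_left.2 (capTime_le _ _)
  refine ⟨r - τ ω, (le_capTime_iff.1 hrc).1, ?_⟩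
  rw [stoppedPrice_shiftAt h, shiftedLevelTime, capTime_of_le (le_capTime_iff.1 hrc).2,
    add_tsub_cancel_of_le hτr]

/-- Eventually the localizing times do not matter. -/
theorem eventually_capTime_eq {ρ : ℕ → PathSpace (State d F) → WithTop ℝ≥0}
    {ω : PathSpace (State d F)} (h : Tendsto (fun k => ρ k ω) atTop (𝓝 ⊤)) (u : ℝ≥0) :
    ∀ᶠ k in atTop, (u : WithTop ℝ≥0) < ρ k ω ∧ capTime (ρ k ω) u = u := by
  filter_upwards [(WithTop.tendsto_nhds_top_iff _).1 h u] with k hk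
  exact ⟨hk, capTime_of_le (le_of_lt hk)⟩

/-- Almost sure convergence of the localized shifted prices. -/
theorem tendsto_indicator_price_capTime {τ : PathSpace (State d F) → ℝ≥0} {n : ℕ}
    {ρ : ℕ → PathSpace (State d F) → WithTop ℝ≥0}
    {ω : PathSpace (State d F)} (h : Tendsto (fun k => ρ k ω) atTop (𝓝 ⊤))
    {A : Set (PathSpace (State d F))} (hA : ∀ ω ∈ A, ⊥ < priceLevelTime n ω) (t : ℝ≥0)
    {X : Type*} [NormedAddCommGroup X] (g : EuclideanSpace ℝ (Fin d) → X) :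
    Tendsto (fun k => ({ω | shiftAt τ ω ∈ A} ∩ {ω | (τ ω : WithTop ℝ≥0) < ρ k ω}).indicator
        (fun ω => g (price (capTime (ρ k ω) (shiftedLevelTime τ n t ω)) ω)) ω) atTop
      (𝓝 ({ω | shiftAt τ ω ∈ A}.indicator
        (fun ω => g (stoppedPrice (priceLevelTime n) t (shiftAt τ ω))) ω)) := by
  refine tendsto_const_nhds.congr' ?_
  filter_upwards [eventually_capTime_eq h (shiftedLevelTime τ n t ω)] with k hk
  by_cases hω : shiftAt τ ω ∈ A
  · rw [Set.indicator_of_mem (s := {ω | shiftAt τ ω ∈ A}) hω, Set.indicator_of_mem, hk.2,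
      stoppedPrice_shiftAt (hA _ hω)]
    exact ⟨hω, lt_of_le_of_lt (WithTop.coe_le_coe.2 le_self_add) hk.1⟩
  · rw [Set.indicator_of_notMem (s := {ω | shiftAt τ ω ∈ A}) hω, Set.indicator_of_notMem]
    exact fun h => hω h.1

variable [MeasurableSpace F]

theorem measurableSet_lt_inter_lt {τ : PathSpace (State d F) → ℝ≥0}
    (hτ : ∀ r, MeasurableSet[rawFiltration (State d F) r] {ω | τ ω < r})
    {ρ : PathSpace (State d F) → WithTop ℝ≥0} (hρ : IsStoppingTime (rawFiltration (State d F)) ρ)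
    (r : ℝ≥0) :
    MeasurableSet[rawFiltration (State d F) r]
      ({ω | (τ ω : WithTop ℝ≥0) < ρ ω} ∩ {ω | τ ω < r}) := by
  obtain ⟨D, hDc, hD⟩ := TopologicalSpace.exists_countable_dense ℝ≥0
  have : {ω | (τ ω : WithTop ℝ≥0) < ρ ω} ∩ {ω | τ ω < r} = ⋃ q ∈ D ∩ Set.Iio r,
      ({ω | τ ω < q} ∩ {ω | ρ ω ≤ (q : ℝ≥0)}ᶜ) := by
    ext ω
    simp only [Set.mem_ofPred_eq, Set.mem_iUnion, Set.mem_inter_iff, exists_prop,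
      Set.mem_compl_iff, not_le, Set.mem_Iio]
    constructor
    · rintro ⟨h1, h2⟩
      have h3 : τ ω < capTime (ρ ω) r := by
        rw [← WithTop.coe_lt_coe, coe_capTime]
        exact lt_min (WithTop.coe_lt_coe.2 h2) h1
      obtain ⟨q, hq, h4, h5⟩ := hD.exists_between h3
      refine ⟨q, ⟨hq, h5.trans_le (capTime_le _ _)⟩, h4, ?_⟩
      rw [← WithTop.coe_lt_coe, coe_capTime] at h5
      exact h5.trans_le (min_le_right _ _)
    · rintro ⟨q, ⟨_, h1⟩, h2, h3⟩
      exact ⟨(WithTop.coe_lt_coe.2 h2).trans h3, h2.trans h1⟩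
  rw [this]
  refine MeasurableSet.biUnion (hDc.mono Set.inter_subset_left) fun q hq => ?_
  exact ((rawFiltration _).mono hq.2.le _ (hτ q)).inter
    ((rawFiltration _).mono hq.2.le _ (hρ q).compl)

variable [SecondCountableTopology F] [BorelSpace F]

theorem measurableSet_shiftedLevelTime_lt [TopologicalSpace.PseudoMetrizableSpace F]
    {τ : PathSpace (State d F) → ℝ≥0}
    (hτ : ∀ r, MeasurableSet[rawFiltration (State d F) r] {ω | τ ω < r}) (n : ℕ) (t r : ℝ≥0) :
    MeasurableSet[rawFiltration (State d F) r] {ω | shiftedLevelTime τ n t ω < r} := by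
  obtain ⟨D, hDc, hD⟩ := TopologicalSpace.exists_countable_dense ℝ≥0
  have : {ω | shiftedLevelTime τ n t ω < r} = ⋃ q ∈ D,
      ({ω | shiftAt τ ω ∈ {ω | capTime (priceLevelTime n ω) t < q}} ∩ {ω | τ ω + q < r}) := by
    ext ω
    simp only [shiftedLevelTime, Set.mem_ofPred_eq, Set.mem_iUnion, Set.mem_inter_iff, exists_prop]
    constructor
    · intro h
      obtain ⟨q, hq, h1, h2⟩ := hD.exists_between (lt_tsub_iff_left.2 h)
      exact ⟨q, hq, h1, lt_tsub_iff_left.1 h2⟩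
    · rintro ⟨q, _, h1, h2⟩
      exact lt_of_le_of_lt (by gcongr) h2
  rw [this]
  refine MeasurableSet.biUnion hDc fun q _ => measurableSet_shiftAt_inter_lt hτ ?_ r
  simp only [capTime_lt_iff]
  by_cases htq : t < q
  · simp [htq]
  · simpa [htq] using (isStoppingTime_priceLevelTime n).measurableSet_lt q

variable [TopologicalSpace.PseudoMetrizableSpace F]
  {Q : Measure (PathSpace (State d F))} [IsProbabilityMeasure Q]
  {τ : PathSpace (State d F) → ℝ≥0} {N : ℝ≥0} {n : ℕ}

/-- Optional sampling for the price stopped at `ρ`, at the time `τ + min t (σ_n ∘ θ_τ)`. -/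
theorem setIntegral_price_shiftedLevelTime
    (hτ : ∀ r, MeasurableSet[rawFiltration (State d F) r] {ω | τ ω < r}) (hN : ∀ ω, τ ω ≤ N)
    {ρ : PathSpace (State d F) → WithTop ℝ≥0} (hρ : IsStoppingTime (rawFiltration (State d F)) ρ)
    (hM : Martingale (stoppedPrice ρ) (rawFiltration (State d F)) Q) {s t T : ℝ≥0} (hst : s ≤ t)
    (htT : t ≤ T) {A : Set (PathSpace (State d F))}
    (hA : MeasurableSet[rawFiltration (State d F) s] A)
    (hAσ : ∀ ω ∈ A, (s : WithTop ℝ≥0) < priceLevelTime n ω) :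
    MeasurableSet ({ω | shiftAt τ ω ∈ A} ∩ {ω | (τ ω : WithTop ℝ≥0) < ρ ω}) ∧
    IntegrableOn (fun ω => price (capTime (ρ ω) (shiftedLevelTime τ n t ω)) ω)
      ({ω | shiftAt τ ω ∈ A} ∩ {ω | (τ ω : WithTop ℝ≥0) < ρ ω}) Q ∧
    ∫ ω in {ω | shiftAt τ ω ∈ A} ∩ {ω | (τ ω : WithTop ℝ≥0) < ρ ω},
        price (capTime (ρ ω) (shiftedLevelTime τ n t ω)) ω ∂Q =
      ∫ ω in {ω | shiftAt τ ω ∈ A} ∩ {ω | (τ ω : WithTop ℝ≥0) < ρ ω},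
        stoppedPrice ρ (N + T + 1) ω ∂Q := by
  set G := {ω | shiftAt τ ω ∈ A} ∩ {ω | (τ ω : WithTop ℝ≥0) < ρ ω} with hG
  have hle := shiftedLevelTime_le hN n htT
  have hset : ∀ r, MeasurableSet[rawFiltration (State d F) r]
      (G ∩ {ω | shiftedLevelTime τ n t ω < r}) := by
    intro r
    -- On `A` the level time exceeds `s`, so the sampling time is at least `τ + s` and the event on
    -- the shifted path is already decided when it occurs.
    have : G ∩ {ω | shiftedLevelTime τ n t ω < r} =
        ({ω | shiftAt τ ω ∈ A} ∩ {ω | τ ω + s < r}) ∩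
          ({ω | (τ ω : WithTop ℝ≥0) < ρ ω} ∩ {ω | τ ω < r}) ∩
            {ω | shiftedLevelTime τ n t ω < r} := by
      ext ω
      simp only [hG, Set.mem_inter_iff, Set.mem_ofPred_eq]
      constructor
      · rintro ⟨⟨h1, h2⟩, h3⟩
        refine ⟨⟨⟨h1, lt_of_le_of_lt ?_ h3⟩, h2, lt_of_le_of_lt le_self_add h3⟩, h3⟩
        exact add_le_add_right (le_capTime_iff.2 ⟨hst, (hAσ _ h1).le⟩) _
      · rintro ⟨⟨⟨h1, _⟩, h2, _⟩, h3⟩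
        exact ⟨⟨h1, h2⟩, h3⟩
    rw [this]
    exact ((measurableSet_shiftAt_inter_lt hτ hA r).inter
      (measurableSet_lt_inter_lt hτ hρ r)).inter (measurableSet_shiftedLevelTime_lt hτ n t r)
  have hGm : MeasurableSet G := by
    have h := (rawFiltration _).le _ _ (hset (N + T + 1))
    have hsub : G ⊆ {ω | shiftedLevelTime τ n t ω < N + T + 1} := fun ω _ =>
      (hle ω).trans_lt (lt_add_one _)
    rwa [Set.inter_eq_left.2 hsub] at h
  obtain ⟨h1, h2⟩ := setIntegral_apply_eq_of_martingale hM
    (continuousWithinAt_stoppedPrice ρ) hset hle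
  have hon : Set.EqOn (fun ω => stoppedPrice ρ (shiftedLevelTime τ n t ω) ω)
      (fun ω => price (capTime (ρ ω) (shiftedLevelTime τ n t ω)) ω) G := fun ω hω =>
    stoppedPrice_of_pos (bot_le.trans_lt hω.2) _
  exact ⟨hGm, h1.congr_fun hon hGm, (setIntegral_congr_fun hGm hon).symm.trans h2⟩

/-- Fatou's lemma: minus `a`, the localized prices are nonnegative. Optional sampling equates their
mean at `t` with that at `0`, where the norm is below `n`. -/
theorem integrable_stoppedPrice_shiftAt
    (hτ : ∀ r, MeasurableSet[rawFiltration (State d F) r] {ω | τ ω < r}) (hN : ∀ ω, τ ω ≤ N)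
    {ρ : ℕ → PathSpace (State d F) → WithTop ℝ≥0}
    (hρ : IsLocalizingSequence (rawFiltration (State d F)) ρ Q)
    (hM : ∀ k, Martingale (stoppedPrice (ρ k)) (rawFiltration (State d F)) Q) {a : ℝ}
    (hlow : ∀ᵐ ω ∂Q, ∀ t i, a ≤ stoppedPrice (priceLevelTime n) t (shiftAt τ ω) i) (t : ℝ≥0) :
    Integrable (fun ω => stoppedPrice (priceLevelTime n) t (shiftAt τ ω)) Q := by
  set A : Set (PathSpace (State d F)) := {ω | ((0 : ℝ≥0) : WithTop ℝ≥0) < priceLevelTime n ω}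
    with hAdef
  have hA := measurableSet_lt_priceLevelTime (d := d) (F := F) n 0
  have hτm : Measurable τ := measurable_of_Iio fun r => (rawFiltration _).le r _ (hτ r)
  have hθ := measurable_shiftAt hτm
  set G := fun k => {ω | shiftAt τ ω ∈ A} ∩ {ω | (τ ω : WithTop ℝ≥0) < ρ k ω} with hGdef
  have key := fun k (t T : ℝ≥0) (htT : t ≤ T) => setIntegral_price_shiftedLevelTime (n := n)
    hτ hN (hρ.isStoppingTime k) (hM k) (zero_le (a := t)) htT hA fun ω hω => hω
  refine Integrable.of_eval_piLp fun i => ?_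
  set f : ℕ → PathSpace (State d F) → ℝ := fun k => (G k).indicator
    fun ω => price (capTime (ρ k ω) (shiftedLevelTime τ n t ω)) ω i - a with hf
  set g : PathSpace (State d F) → ℝ := {ω | shiftAt τ ω ∈ A}.indicator
    fun ω => stoppedPrice (priceLevelTime n) t (shiftAt τ ω) i - a with hg
  have hGm : ∀ k, MeasurableSet (G k) := fun k => (key k t t le_rfl).1
  have hint : ∀ k, IntegrableOn (fun ω =>
      price (capTime (ρ k ω) (shiftedLevelTime τ n t ω)) ω i) (G k) Q := fun k =>
    Integrable.eval_piLp (key k t t le_rfl).2.1 i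
  have hfint : ∀ k, Integrable (f k) Q := fun k =>
    (integrable_indicator_iff (hGm k)).2 ((hint k).sub (integrable_const a))
  have hf0 : ∀ k, 0 ≤ᵐ[Q] f k := by
    intro k
    filter_upwards [hlow] with ω hω
    refine Set.indicator_apply_nonneg fun hωG => ?_
    obtain ⟨u, _, hu⟩ := exists_price_capTime_shiftedLevelTime_eq hωG.1 hωG.2 t
    simp only [hu]
    exact sub_nonneg.2 (hω u i)
  have hbound : ∀ k, ∫ ω, f k ω ∂Q ≤ n + |a| := by
    intro k
    -- Both sides equal the integral at the common horizon `N + t + 1`.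
    have h1 : ∫ ω in G k, price (capTime (ρ k ω) (shiftedLevelTime τ n t ω)) ω ∂Q =
        ∫ ω in G k, price (capTime (ρ k ω) (shiftedLevelTime τ n 0 ω)) ω ∂Q :=
      (key k t t le_rfl).2.2.trans (key k 0 t zero_le).2.2.symm
    have h2 : ‖∫ ω in G k, price (capTime (ρ k ω) (shiftedLevelTime τ n 0 ω)) ω ∂Q‖ ≤
        n * Q.real (G k) := by
      refine norm_setIntegral_le_of_norm_le_const (measure_lt_top _ _) fun ω hω => ?_
      obtain ⟨u, hu0, hu⟩ := exists_price_capTime_shiftedLevelTime_eq hω.1 hω.2 0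
      obtain rfl : u = 0 := le_antisymm hu0 zero_le
      rw [hu, stoppedPrice_of_pos hω.1]
      refine (norm_price_lt_of_lt_priceLevelTime ?_).le
      exact (WithTop.coe_le_coe.2 (capTime_le _ _)).trans_lt hω.1
    have h3 : ∫ ω in G k, price (capTime (ρ k ω) (shiftedLevelTime τ n t ω)) ω i ∂Q ≤ n := by
      rw [← eval_integral_piLp fun i => Integrable.eval_piLp (key k t t le_rfl).2.1 i]
      rw [h1]
      refine (Real.le_norm_self _).trans ((PiLp.norm_apply_le _ i).trans ?_)
      refine h2.trans (mul_le_of_le_one_right (by positivity) measureReal_le_one)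
    have h4 : -∫ _ω in G k, a ∂Q ≤ |a| := by
      rw [setIntegral_const, smul_eq_mul, ← mul_neg]
      refine (mul_le_mul_of_nonneg_left (neg_le_abs a) measureReal_nonneg).trans ?_
      exact mul_le_of_le_one_left (abs_nonneg a) measureReal_le_one
    rw [hf, integral_indicator (hGm k), integral_sub (hint k) (integrable_const a)]
    linarith
  have hlim : ∀ᵐ ω ∂Q, Tendsto (fun k => f k ω) atTop (𝓝 (g ω)) := by
    filter_upwards [hρ.tendsto_top] with ω hω
    exact tendsto_indicator_price_capTime hω (fun ω hω => hω) t fun y => y i - a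
  have hgmem : MemLp g 1 Q := by
    refine ⟨aestronglyMeasurable_of_tendsto_ae atTop (fun k => (hfint k).1) hlim, ?_⟩
    refine (Lp.eLpNorm_lim_le_liminf_eLpNorm (fun k => (hfint k).1) g hlim).trans_lt ?_
    refine lt_of_le_of_lt (b := ENNReal.ofReal (n + |a|)) ?_ ENNReal.ofReal_lt_top
    refine liminf_le_of_frequently_le' (Frequently.of_forall fun k => ?_)
    rw [eLpNorm_one_eq_lintegral_enorm, ← ofReal_integral_norm_eq_lintegral_enorm (hfint k)]
    refine ENNReal.ofReal_le_ofReal (le_trans (le_of_eq ?_) (hbound k))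
    refine integral_congr_ae ?_
    filter_upwards [hf0 k] with ω hω
    exact abs_of_nonneg hω
  have hAθ : MeasurableSet {ω | shiftAt τ ω ∈ A} := hθ ((rawFiltration _).le _ _ hA)
  -- Adds `a` back where the level time is positive; elsewhere the stopped price is zero by
  -- convention.
  have := (memLp_one_iff_integrable.1 hgmem).add ((integrable_const a).indicator hAθ)
  refine this.congr (ae_of_all _ fun ω => ?_)
  by_cases hω : shiftAt τ ω ∈ A
  · simp [hg, hω]
  · simp [hg, hω, stoppedPrice_of_not_pos (show ¬ ⊥ < priceLevelTime n (shiftAt τ ω) from hω)]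

/-- The price of the shifted path, stopped on reaching the level `n`, is a martingale. -/
theorem martingale_stoppedPrice_map_shiftAt
    (hτ : ∀ r, MeasurableSet[rawFiltration (State d F) r] {ω | τ ω < r}) (hN : ∀ ω, τ ω ≤ N)
    (hQ : IsLocalMartingalePrice Q) {a : ℝ}
    (hlow : ∀ᵐ ω ∂Q, ∀ t i, a ≤ stoppedPrice (priceLevelTime n) t (shiftAt τ ω) i) :
    Martingale (stoppedPrice (priceLevelTime n)) (rawFiltration (State d F))
      (Q.map (shiftAt τ)) := by
  obtain ⟨ρ, hρ, hM⟩ := hQ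
  -- `stoppedPrice` is by definition the process appearing in `Locally`, including the value zero on
  -- `{ρ = 0}`.
  have hM' : ∀ k, Martingale (stoppedPrice (ρ k)) (rawFiltration (State d F)) Q := hM
  have hτm : Measurable τ := measurable_of_Iio fun r => (rawFiltration _).le r _ (hτ r)
  have hθ := measurable_shiftAt hτm
  have hprob : IsProbabilityMeasure (Q.map (shiftAt τ)) :=
    Measure.isProbabilityMeasure_map hθ.aemeasurable
  have hadapt := stronglyAdapted_stoppedPrice
    (isStoppingTime_priceLevelTime (d := d) (F := F) n)
  have hsm : ∀ t, StronglyMeasurable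
      (stoppedPrice (d := d) (F := F) (priceLevelTime n) t) := fun t =>
    (hadapt t).mono ((rawFiltration _).le t)
  have hint := integrable_stoppedPrice_shiftAt hτ hN hρ hM' hlow
  refine martingale_of_forall_setIntegral_eq hadapt
    (fun t => (integrable_map_measure (hsm t).aestronglyMeasurable hθ.aemeasurable).2 (hint t))
    fun s t hst A hA => ?_
  have hAm := (rawFiltration _).le _ _ hA
  rw [setIntegral_map hAm (hsm s).aestronglyMeasurable hθ.aemeasurable,
    setIntegral_map hAm (hsm t).aestronglyMeasurable hθ.aemeasurable]
  -- Where the level time is at most `s`, the stopped price does not move between `s` and `t`; only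
  -- `B` needs optional sampling.
  set B : Set (PathSpace (State d F)) := A ∩ {ω | (s : WithTop ℝ≥0) < priceLevelTime n ω} with hB
  have hBs : MeasurableSet[rawFiltration (State d F) s] B :=
    hA.inter (measurableSet_lt_priceLevelTime n s)
  have hBm : MeasurableSet {ω | shiftAt τ ω ∈ B} := hθ ((rawFiltration _).le _ _ hBs)
  have hBpos : ∀ ω ∈ B, ⊥ < priceLevelTime n ω := fun ω hω => bot_le.trans_lt hω.2
  have key := fun k (t T : ℝ≥0) (hst : s ≤ t) (htT : t ≤ T) =>
    setIntegral_price_shiftedLevelTime (n := n) hτ hN (hρ.isStoppingTime k) (hM' k) hst htT hBs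
      fun ω hω => hω.2
  have hlim : ∀ r, s ≤ r → Tendsto (fun k => ∫ ω in {ω | shiftAt τ ω ∈ B} ∩
        {ω | (τ ω : WithTop ℝ≥0) < ρ k ω},
        price (capTime (ρ k ω) (shiftedLevelTime τ n r ω)) ω ∂Q) atTop
      (𝓝 (∫ ω in {ω | shiftAt τ ω ∈ B},
        stoppedPrice (priceLevelTime n) r (shiftAt τ ω) ∂Q)) := by
    intro r hsr
    have hGm := fun k => (key k r r hsr le_rfl).1
    simp only [← integral_indicator hBm, ← integral_indicator (hGm _)]
    refine tendsto_integral_of_dominated_convergence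
      (fun ω => n + ‖stoppedPrice (priceLevelTime n) r (shiftAt τ ω)‖)
      (fun k => ((integrable_indicator_iff (hGm k)).2 (key k r r hsr le_rfl).2.1).1)
      ((integrable_const _).add (hint r).norm) (fun k => ae_of_all _ fun ω => ?_) ?_
    · by_cases hω : ω ∈ {ω | shiftAt τ ω ∈ B} ∩ {ω | (τ ω : WithTop ℝ≥0) < ρ k ω}
      · rw [Set.indicator_of_mem hω]
        obtain ⟨u, hur, hu⟩ :=
          exists_price_capTime_shiftedLevelTime_eq (hBpos _ hω.1) hω.2 r
        rw [hu]
        exact norm_stoppedPrice_priceLevelTime_le n u r _ hur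
      · rw [Set.indicator_of_notMem hω, norm_zero]
        positivity
    · filter_upwards [hρ.tendsto_top] with ω hω
      exact tendsto_indicator_price_capTime hω hBpos r id
  have hBeq : ∫ ω in {ω | shiftAt τ ω ∈ B}, stoppedPrice (priceLevelTime n) s (shiftAt τ ω) ∂Q =
      ∫ ω in {ω | shiftAt τ ω ∈ B}, stoppedPrice (priceLevelTime n) t (shiftAt τ ω) ∂Q :=
    tendsto_nhds_unique (hlim s le_rfl) ((hlim t hst).congr fun k =>
      (key k t t hst le_rfl).2.2.trans (key k s t le_rfl hst).2.2.symm)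
  have hAθ : MeasurableSet (shiftAt τ ⁻¹' A) := hθ hAm
  have hsub : {ω | shiftAt τ ω ∈ B} ⊆ shiftAt τ ⁻¹' A := fun ω hω => hω.1
  have hrest : ∫ ω in shiftAt τ ⁻¹' A \ {ω | shiftAt τ ω ∈ B},
        stoppedPrice (priceLevelTime n) s (shiftAt τ ω) ∂Q =
      ∫ ω in shiftAt τ ⁻¹' A \ {ω | shiftAt τ ω ∈ B},
        stoppedPrice (priceLevelTime n) t (shiftAt τ ω) ∂Q := by
    refine setIntegral_congr_fun (hAθ.diff hBm) fun ω hω => ?_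
    have hle : priceLevelTime n (shiftAt τ ω) ≤ s := not_lt.1 fun h => hω.2 ⟨hω.1, h⟩
    by_cases hpos : ⊥ < priceLevelTime n (shiftAt τ ω)
    · simp only [stoppedPrice_of_pos hpos, capTime_eq_capTime_of_le hst hle]
    · simp only [stoppedPrice_of_not_pos hpos]
  have hsplit := fun r => integral_inter_add_sdiff (s := shiftAt τ ⁻¹' A) hBm
    (hint r).integrableOn
  simp only [Set.inter_eq_right.2 hsub] at hsplit
  rw [← hsplit s, ← hsplit t, hrest, hBeq]

end ShiftedMartingale

/-! ### Uniform lower bounds and localization by level times -/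

section Assembly

variable {d : ℕ} {F : Type*} [TopologicalSpace F] [MeasurableSpace F]

theorem measurableSet_forall_le_stoppedPrice (n : ℕ) (c : ℝ) :
    MeasurableSet {ω : PathSpace (State d F) |
      ∀ t i, c ≤ stoppedPrice (priceLevelTime n) t ω i} := by
  obtain ⟨D, hDc, hD⟩ := TopologicalSpace.exists_countable_dense ℝ≥0
  have : {ω : PathSpace (State d F) | ∀ t i, c ≤ stoppedPrice (priceLevelTime n) t ω i} =
      ⋂ q ∈ D, ⋂ i, {ω | c ≤ stoppedPrice (priceLevelTime n) q ω i} := by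
    ext ω
    simp only [Set.mem_ofPred_eq, Set.mem_iInter]
    refine ⟨fun h q _ i => h q i, fun h t i => ?_⟩
    refine mem_of_isClosed_of_forall_dense (continuousWithinAt_stoppedPrice _ ω)
      (C := {y | c ≤ y i}) (isClosed_le continuous_const (by fun_prop)) hD (lt_add_one t)
      fun q hq _ _ => h q hq i
  rw [this]
  refine MeasurableSet.biInter hDc fun q _ => MeasurableSet.iInter fun i => ?_
  have hm := ((stronglyAdapted_stoppedPrice
    (isStoppingTime_priceLevelTime (d := d) (F := F) n) q).mono ((rawFiltration _).le q)).measurable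
  exact measurableSet_le measurable_const ((EuclideanSpace.proj i).continuous.measurable.comp hm)

/-- The price stopped on reaching a level is bounded from below for every starting point. -/
theorem UniformlyLocallyBoundedBelow.exists_le_stoppedPrice
    {P : Kernel (State d F) (PathSpace (State d F))} (hBelow : UniformlyLocallyBoundedBelow P)
    (hstart : ∀ x, ∀ᵐ ω ∂(P x), coord 0 ω = x) (n : ℕ) :
    ∃ c : ℝ, ∀ y, ∀ᵐ ω ∂(P y), ∀ t i, c ≤ stoppedPrice (priceLevelTime n) t ω i := by
  obtain ⟨a, ha⟩ := hBelow n
  -- Starting points of norm at least `n` have level time `0`, hence stopped price `0`.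
  refine ⟨min a 0, fun y => ?_⟩
  by_cases hy : ‖y.2.1‖ < n
  · filter_upwards [ha y hy] with ω hω t i
    by_cases hpos : ⊥ < priceLevelTime n ω
    · rw [stoppedPrice_of_pos hpos]
      have hle : (capTime (priceLevelTime n ω) t : WithTop ℝ≥0) ≤ priceExit n ω :=
        ((coe_capTime _ _).le.trans (min_le_right _ _)).trans (priceLevelTime_le_priceExit n ω)
      have h := hω (capTime (priceLevelTime n ω) t) i
      rw [stoppedProcess_eq_of_le hle] at h
      exact (min_le_left _ _).trans h
    · rw [stoppedPrice_of_not_pos hpos]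
      exact min_le_right _ _
  · filter_upwards [hstart y] with ω hω t i
    have hpos : ¬ ⊥ < priceLevelTime n ω := fun h => hy (by
      have h1 := norm_price_lt_of_lt_priceLevelTime (t := 0) h
      rwa [price, hω] at h1)
    rw [stoppedPrice_of_not_pos hpos]
    exact min_le_right _ _

theorem isLocalMartingalePrice_of_forall_martingale {Q : Measure (PathSpace (State d F))}
    (h : ∀ n, Martingale (stoppedPrice (priceLevelTime n)) (rawFiltration (State d F)) Q) :
    IsLocalMartingalePrice Q :=
  ⟨priceLevelTime, ⟨⟨isStoppingTime_priceLevelTime, ae_of_all _ tendsto_priceLevelTime⟩,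
    ae_of_all _ priceLevelTime_mono⟩, h⟩

end Assembly

end CanonicalPath

theorem mainTheorem7 {d : ℕ} {F : Type*} [TopologicalSpace F] [LocallyCompactSpace F] [T2Space F]
    [SecondCountableTopology F] [MeasurableSpace F] [BorelSpace F]
    (P : Kernel (CanonicalPath.State d F) (CanonicalPath.PathSpace (CanonicalPath.State d F)))
    (hMarkov : CanonicalPath.IsCanonicalStrongMarkov P)
    (hHorizon : CanonicalPath.FiniteHorizon P)
    (hNFLVR : ∀ x, (CanonicalPath.equivLocalMartingaleMeasures P x).Nonempty)
    (hBelow : CanonicalPath.UniformlyLocallyBoundedBelow P) :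
    CanonicalPath.ConditionalLawsBelong (CanonicalPath.equivLocalMartingaleMeasures P)
      (CanonicalPath.boundedStoppingTimes (CanonicalPath.State d F)) := by
  open CanonicalPath in
  rintro x Q ⟨hQprob, hQP, hPQ, hQloc⟩ τ hτ
  have := hMarkov.isMarkovKernel
  have hτm := measurable_of_isStoppingTime_rightFiltration hτ.1
  have hX := measurable_coordAt hτm
  have hθ := measurable_shiftAt hτm
  have hpair : Measurable fun ω => (coordAt τ ω, shiftAt τ ω) := hX.prodMk hθ
  have hPdis := (hMarkov.isRegularCondDistrib hτ x).2
  -- Equivalence of `Q` and `P x` passes to the joint law and to the law of `X_τ`; the strong Markov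
  -- disintegration links the two.
  have hν₁ : Q.map (fun ω => (coordAt τ ω, shiftAt τ ω)) ≪ Q.map (coordAt τ) ⊗ₘ P := by
    refine (hQP.map hpair).trans ?_
    rw [hPdis]
    exact (hPQ.map hX).compProd_left P
  have hν₂ : Q.map (coordAt τ) ⊗ₘ P ≪ Q.map (fun ω => (coordAt τ ω, shiftAt τ ω)) := by
    refine Measure.AbsolutelyContinuous.trans ?_ (hPQ.map hpair)
    rw [hPdis]
    exact (hQP.map hX).compProd_left P
  have hprobX : IsProbabilityMeasure (Q.map (coordAt τ)) :=
    Measure.isProbabilityMeasure_map hX.aemeasurable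
  have hprobθ : IsProbabilityMeasure (Q.map (shiftAt τ)) :=
    Measure.isProbabilityMeasure_map hθ.aemeasurable
  refine ⟨exists_isMarkovKernel_compProd_eq (Measure.fst_map_prodMk hθ) hν₁, ?_⟩
  rintro κ ⟨hκ, hdis⟩
  -- Countable generation lets absolute continuity of composition products descend to almost every
  -- fibre.
  have hgen : MeasurableSpace.CountablyGenerated (PathSpace (State d F)) :=
    countablyGenerated_pathSpace
  have hac₁ : ∀ᵐ y ∂(Q.map (coordAt τ)), κ y ≪ P y := by
    rw [hdis] at hν₁
    exact hν₁.kernel_of_compProd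
  have hac₂ : ∀ᵐ y ∂(Q.map (coordAt τ)), P y ≪ κ y := by
    rw [hdis] at hν₂
    exact hν₂.kernel_of_compProd
  obtain ⟨N, hN⟩ := hτ.2
  have hlt := measurableSet_lt_of_isStoppingTime_rightFiltration hτ.1
  have hmap₀ : (Q.map (shiftAt τ)).map (coord 0) = Q.map (coordAt τ) := by
    rw [Measure.map_map (measurable_coord 0) hθ]
    exact congrArg (fun f => Q.map f) (funext (coord_zero_shiftAt τ))
  -- Conditioning `θ_τ` on `X_τ` under `Q` is conditioning the path on its initial state under the
  -- law of `θ_τ`.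
  have hmap : (Q.map (shiftAt τ)).map (fun ω => (coord 0 ω, ω)) =
      (Q.map (shiftAt τ)).map (coord 0) ⊗ₘ κ := by
    rw [hmap₀, ← hdis, Measure.map_map (g := fun ω => (coord 0 ω, ω))
      ((measurable_coord 0).prodMk measurable_id) hθ]
    exact congrArg (fun f => Q.map f)
      (funext fun ω => Prod.ext (coord_zero_shiftAt τ ω) rfl)
  have hmart : ∀ᵐ y ∂(Q.map (coordAt τ)), ∀ n,
      Martingale (stoppedPrice (priceLevelTime n)) (rawFiltration (State d F)) (κ y) := by
    refine ae_all_iff.2 fun n => ?_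
    obtain ⟨c, hc⟩ := hBelow.exists_le_stoppedPrice hMarkov.start n
    have hH := measurableSet_forall_le_stoppedPrice (d := d) (F := F) n c
    have hlowP : ∀ᵐ ω ∂(P x), ∀ t i,
        c ≤ stoppedPrice (priceLevelTime n) t (shiftAt τ ω) i := by
      refine ae_of_ae_map (f := fun ω => (coordAt τ ω, shiftAt τ ω)) hpair.aemeasurable
        (p := fun q => ∀ t i, c ≤ stoppedPrice (priceLevelTime n) t q.2 i) ?_
      rw [hPdis]
      exact Measure.ae_compProd_of_ae_ae (measurable_snd hH) (ae_of_all _ hc)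
    have hM := martingale_stoppedPrice_map_shiftAt hlt hN hQloc (hQP.ae_le hlowP)
    rw [← hmap₀]
    exact ae_martingale_of_map_eq_compProd countablyGenerated_rawFiltration
      (measurable_coord_rawFiltration le_rfl) hmap hM (continuousWithinAt_stoppedPrice _)
      (norm_stoppedPrice_priceLevelTime_le n)
  filter_upwards [hac₁, hac₂, hmart] with y h₁ h₂ h₃
  exact ⟨hκ.isProbabilityMeasure y, h₁, h₂, isLocalMartingalePrice_of_forall_martingale h₃⟩
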